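/- Let $\beta>0$, let $M$ be a symmetric positive definite $d\times d$ matrix, and let $\xi:\mathbb R^d\to\mathbb R^n$ be smooth with $\mathcal M_0=\{q:\xi(q)=0\}\neq\emptyset$ and with surjective derivative at every point of $\{q:\|\xi(q)\|<r\}$, for some $r>0$. Let $U:\mathbb R^d\times\mathbb R^n\to\mathbb R$ be continuous and confining in the following sense: there are $K:\mathbb R^n\to\mathbb R$ bounded below and $W:\mathbb R^d\to[0,\infty)$ with $$U(q,z)\ \ge\ K(z)+W(q)\qquad\text{for all } q,z,$$ $K(z)>c\log\|z\|$ for all sufficiently large $\|z\|$, where $c>n/\beta$, $\int_{\mathbb R^d}e^{-\beta W(q)}\,dq<\infty$, and $$\forall \eta>0\ \ \exists R\in\mathbb R,\ s_0>0\ \ \forall s\in(0,s_0):\qquad \int_{\{\|q\|>R,\ \|\xi(q)\|<s\}}e^{-\beta W(q)}\,dq\ \le\ \eta\, s^n .$$ For $\|z\|<r$ let $\delta_{\xi(q)=z}(dq)$ denote the conditional measure of Lebesgue measure on $\{\xi=z\}$: the family of locally finite measures with $\delta_{\xi(q)=z}(\{\xi\ne z\})=0$, with $dq=\delta_{\xi(q)=z}(dq)\,dz$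 on $\{\|\xi\|<r\}$, and with $z\mapsto\int\varphi(q)\,\delta_{\xi(q)=z}(dq)$ continuous on $\{\|z\|<r\}$ for every continuous compactly supported $\varphi$. Such a family, measurable in $z$, exists and is unique on $\{\|z\|<r\}$. For every $\epsilon>0$, $$\mu_\epsilon(dp\,dq)=\frac1{Z_\epsilon}\,e^{-\beta\left(\frac12p^TM^{-1}p+U(q,\xi(q)/\epsilon)\right)}\,dp\,dq$$ is a well-defined probability measure on $\mathbb R^d\times\mathbb R^d$ ($0<Z_\epsilon<\infty$), and the effective potential $V_{\rm eff}(q)=-\frac1\beta\ln\int_{\mathbb R^n}e^{-\beta U(q,z)}\,dz$ is well defined, the integral being finite for every $q$. As $\epsilon\to0^+$, $\mu_\epsilon$ converges in distribution (against all bounded continuous functions of $(p,q)$) to the probability measure $$\mu_0(dp\,dq)=\frac1{Z_0}\,e^{-\beta\left(\frac12p^TM^{-1}p+V_{\rm eff}(q)\right)}\,dp\,\delta_{\xi(q)=0}(dq),\qquad 0<Z_0<\infty,$$ which is supported on the slow manifold, i.e. $\mu_0(\{(p,q):\xi(q)\neq0\})=0$. Its marginal distribution in $q$ is the probability measure obtained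 by normalizing $e^{-\beta V_{\rm eff}(q)}\,\delta_{\xi(q)=0}(dq)$, whose total mass is finite and positive. -/

import Mathlib

open MeasureTheory Filter Topology Set
open scoped ContDiff Matrix

/-- The Euclidean space `ℝ^d`. -/
abbrev Euc (d : ℕ) : Type := EuclideanSpace ℝ (Fin d)

/-- The kinetic energy `p ↦ ½ pᵀ M⁻¹ p` for the mass matrix `M`. -/
noncomputable def kineticEnergy {d : ℕ} (M : Matrix (Fin d) (Fin d) ℝ) (p : Euc d) : ℝ :=
  (1 / 2) * (p.ofLp ⬝ᵥ (M⁻¹ *ᵥ p.ofLp))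

/-- The Boltzmann (canonical) distribution `Z⁻¹ exp (-β H(x)) ν(dx)`, with
`Z = ∫ exp (-β H) dν`, of a Hamiltonian `H` relative to a reference measure `ν`. It is a genuine
normalized measure when `exp (-β H)` is `ν`-integrable and `ν ≠ 0`. -/
noncomputable def boltzmann {X : Type*} [MeasurableSpace X] (ν : Measure X) (β : ℝ)
    (H : X → ℝ) : Measure X :=
  ν.tilted (fun x => -β * H x)

/-- The stiff Hamiltonian `½ pᵀ M⁻¹ p + U(q, ξ(q)/ε)` on the phase space of pairs `(p, q)`. -/
noncomputable def stiffHamiltonian {d n : ℕ} (M : Matrix (Fin d) (Fin d) ℝ)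
    (U : Euc d → Euc n → ℝ) (ξ : Euc d → Euc n) (ε : ℝ) (x : Euc d × Euc d) : ℝ :=
  kineticEnergy M x.1 + U x.2 (ε⁻¹ • ξ x.2)

/-- The effective potential `V_eff(q) = -β⁻¹ ln ∫ exp (-β U(q,z)) dz`. -/
noncomputable def effPotential {d n : ℕ} (β : ℝ) (U : Euc d → Euc n → ℝ) (q : Euc d) : ℝ :=
  -(1 / β) * Real.log (∫ z : Euc n, Real.exp (-β * U q z))

/-- The effective Hamiltonian `½ pᵀ M⁻¹ p + V_eff(q)`. -/
noncomputable def effHamiltonian {d n : ℕ} (M : Matrix (Fin d) (Fin d) ℝ) (β : ℝ)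
    (U : Euc d → Euc n → ℝ) (x : Euc d × Euc d) : ℝ :=
  kineticEnergy M x.1 + effPotential β U x.2

/-- `κ z` is the conditional measure `δ_{ξ(q)=z}(dq)` for all `‖z‖ < r`: a (locally finite) measure
carried by the level set `{ξ = z}`, such that `dq = δ_{ξ(q)=z}(dq) dz` on `{‖ξ‖ < r}`.
The chain rule alone determines `κ z` only for almost every `z`; the value at each single `z` is
fixed by taking the version which depends continuously on `z`. -/
structure IsConditionalMeasure {d n : ℕ} (ξ : Euc d → Euc n) (r : ℝ)
    (κ : ProbabilityTheory.Kernel (Euc n) (Euc d)) : Prop where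
  locallyFinite : ∀ z, ‖z‖ < r → IsLocallyFiniteMeasure (κ z)
  carried : ∀ z, ‖z‖ < r → κ z {q | ξ q ≠ z} = 0
  chain_rule : ∀ A : Set (Euc d), MeasurableSet A →
    volume (A ∩ {q | ‖ξ q‖ < r}) = ∫⁻ z in Metric.ball 0 r, κ z A
  continuous : ∀ φ : Euc d → ℝ, Continuous φ → HasCompactSupport φ →
    ContinuousOn (fun z => ∫ q, φ q ∂(κ z)) (Metric.ball 0 r)

/-! Write `u q z = exp (-β U q z)`, so that `∫ z, u q z` is `exp (-β V_eff)`. The mass of `u q (ξ q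
/ ε)` concentrates in an `ε`-layer around `{ξ = 0}` and is of order `ε ^ n`. Disintegrating `dq = κ
z (dq) dz` over a ball and substituting `z = ε y` turns the integral of `φ q * u q (ξ q / ε)`,
divided by `ε ^ n`, into an integral over `y` of `∫ q, φ q * u q y ∂(κ (ε y))`. For compactly
supported `φ`, weak continuity of `κ` at `0` and domination in `y` give the limit `∫ q, φ q * exp
(-β V_eff q) ∂(κ 0)` (`StiffWeight.tendsto_vague`). Logarithmic growth of `K` supplies the
domination: `u` decays like `(1 + ‖z‖) ^ (-β c)` with `β c > n`, which also makes the part with `‖ξ‖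
≥ δ` of size `ε ^ (β c - n)` after rescaling.

Bounded test functions require that no mass escape to infinity in `q`
(`StiffWeight.eventually_tail_le`). The tail hypothesis bounds the `w`-mass, `w = exp (-β W)`, of
thin layers at large `‖q‖` by a small multiple of `s ^ n`, and a layer-cake argument carries this
bound from indicators of balls to the decreasing profile of `u`. Vague convergence and tightness
together yield weak convergence and finiteness of the limit (`tendsto_integral_of_vague_of_tight`).
The factor `ε ^ n` cancels on normalizing, and the momentum is an independent Gaussian factor.

The measures `κ z` exist because near a regular point `ξ` becomes affine in suitable coordinates,
where Fubini applies (`exists_local_disintegration`); countably many local pieces are glued by a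
normalized sum (`exists_isConditionalMeasure`). Continuity in `z` makes them unique. -/

namespace IsConditionalMeasure

/-! ### Disintegration formula and uniqueness of the conditional measures -/

variable {d n : ℕ} {ξ : Euc d → Euc n} {r : ℝ} {κ κ' : ProbabilityTheory.Kernel (Euc n) (Euc d)}

lemma ae_eq (h : IsConditionalMeasure ξ r κ) {z : Euc n} (hz : ‖z‖ < r) :
    ∀ᵐ q ∂κ z, ξ q = z := by
  rw [ae_iff]
  exact h.carried z hz

lemma bind_eq (h : IsConditionalMeasure ξ r κ) :
    (volume.restrict (Metric.ball 0 r)).bind κ = volume.restrict {q | ‖ξ q‖ < r} := by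
  ext A hA
  rw [Measure.bind_apply hA κ.measurable.aemeasurable, Measure.restrict_apply hA, h.chain_rule A hA]

/-- Integrals over `{ξ ∈ B}` disintegrate along the level sets of `ξ`. -/
lemma setIntegral_preimage (h : IsConditionalMeasure ξ r κ) (hξ : Continuous ξ)
    {f : Euc d → ℝ} (hf : Integrable f) {B : Set (Euc n)} (hB : MeasurableSet B)
    (hBr : B ⊆ Metric.ball 0 r) :
    ∫ q in ξ ⁻¹' B, f q = ∫ z in B, ∫ q, f q ∂(κ z) := by
  have hB' : MeasurableSet (ξ ⁻¹' B) := hξ.measurable hB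
  let g : Euc d → ℝ := (ξ ⁻¹' B).indicator f
  have hg : Integrable g (volume.restrict {q | ‖ξ q‖ < r}) := (hf.indicator hB').restrict
  -- Seen as a kernel composition with a constant kernel, restricted Lebesgue measure obeys the
  -- Bochner form of the disintegration, `Kernel.integral_comp`.
  have hcomp : (κ.comp (ProbabilityTheory.Kernel.const Unit
      (volume.restrict (Metric.ball (0 : Euc n) r)))) () = volume.restrict {q | ‖ξ q‖ < r} := by
    rw [ProbabilityTheory.Kernel.comp_apply, ProbabilityTheory.Kernel.const_apply, h.bind_eq]
  have key : ∫ q, g q ∂(volume.restrict {q | ‖ξ q‖ < r})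
      = ∫ z, ∫ q, g q ∂(κ z) ∂(volume.restrict (Metric.ball 0 r)) := by
    rw [← hcomp] at hg
    have := ProbabilityTheory.Kernel.integral_comp hg
    rwa [hcomp, ProbabilityTheory.Kernel.const_apply] at this
  have h1 : ∫ q, g q ∂(volume.restrict {q | ‖ξ q‖ < r}) = ∫ q in ξ ⁻¹' B, f q := by
    rw [setIntegral_indicator hB']
    congr 2
    refine Set.inter_eq_right.2 fun q hq => ?_
    simpa using hBr hq
  have h2 : ∫ z in Metric.ball 0 r, ∫ q, g q ∂(κ z)
      = ∫ z in Metric.ball 0 r, B.indicator (fun z => ∫ q, f q ∂(κ z)) z := by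
    refine setIntegral_congr_fun Metric.isOpen_ball.measurableSet fun z hz => ?_
    have hz' : ‖z‖ < r := by simpa using hz
    by_cases hzB : z ∈ B
    · simp only [Set.indicator_of_mem hzB]
      refine integral_congr_ae ?_
      filter_upwards [h.ae_eq hz'] with q hq
      exact Set.indicator_of_mem (by simpa [hq] using hzB) _
    · simp only [Set.indicator_of_notMem hzB]
      refine integral_eq_zero_of_ae ?_
      filter_upwards [h.ae_eq hz'] with q hq
      exact Set.indicator_of_notMem (by simpa [hq] using hzB) _
  rw [← h1, key, h2, setIntegral_indicator hB, Set.inter_eq_right.2 hBr]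

/-- The conditional measures are unique. -/
lemma unique (h : IsConditionalMeasure ξ r κ) (h' : IsConditionalMeasure ξ r κ')
    (hξ : Continuous ξ) {z : Euc n} (hz : ‖z‖ < r) : κ' z = κ z := by
  have := h.locallyFinite z hz
  have := h'.locallyFinite z hz
  refine Measure.ext_of_integral_eq_on_compactlySupported fun f => ?_
  have hc := h.continuous f f.continuous f.hasCompactSupport
  have hc' := h'.continuous f f.continuous f.hasCompactSupport
  have hf : Integrable f (volume : Measure (Euc d)) :=
    f.continuous.integrable_of_hasCompactSupport f.hasCompactSupport
  have hint : ∀ {κ : ProbabilityTheory.Kernel (Euc n) (Euc d)}, IsConditionalMeasure ξ r κ →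
      IntegrableOn (fun z => ∫ q, f q ∂(κ z)) (Metric.ball 0 r) := by
    intro κ h
    have hcomp : (κ.comp (ProbabilityTheory.Kernel.const Unit
        (volume.restrict (Metric.ball (0 : Euc n) r)))) () = volume.restrict {q | ‖ξ q‖ < r} := by
      rw [ProbabilityTheory.Kernel.comp_apply, ProbabilityTheory.Kernel.const_apply, h.bind_eq]
    have hg : Integrable f (volume.restrict {q | ‖ξ q‖ < r}) := hf.restrict
    rw [← hcomp] at hg
    have := hg.integral_comp
    rwa [ProbabilityTheory.Kernel.const_apply] at this
  have hae : (fun z => ∫ q, f q ∂(κ' z)) =ᵐ[volume.restrict (Metric.ball 0 r)]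
      fun z => ∫ q, f q ∂(κ z) := by
    -- Over any measurable part of the ball both integrals equal the Lebesgue integral of `f` over
    -- the preimage under `ξ`, so they agree for almost every `z`; continuity on the ball then
    -- removes the exceptional set.
    refine (hint h').ae_eq_of_forall_setIntegral_eq _ _ (hint h) fun s hs _ => ?_
    rw [Measure.restrict_restrict hs,
      ← h'.setIntegral_preimage hξ hf (hs.inter Metric.isOpen_ball.measurableSet)
        Set.inter_subset_right,
      ← h.setIntegral_preimage hξ hf (hs.inter Metric.isOpen_ball.measurableSet)
        Set.inter_subset_right]
  exact Measure.eqOn_open_of_ae_eq hae Metric.isOpen_ball hc' hc (by simpa using hz)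

end IsConditionalMeasure

/-! ### Existence of the conditional measures -/

/-- Given a surjective linear map `L` with a right inverse `R`, Lebesgue measure disintegrates
along the fibres of `L`. -/
lemma exists_lintegral_eq_lintegral_fibre {d n : ℕ} (L : Euc d →L[ℝ] Euc n)
    (R : Euc n →L[ℝ] Euc d) (hLR : ∀ z, L (R z) = z) :
    ∃ c : ℝ, 0 < c ∧ ∀ g : Euc d → ENNReal, Measurable g →
      ∫⁻ x, g x = ENNReal.ofReal c * ∫⁻ z : Euc n, ∫⁻ w : L.toLinearMap.ker, g (R z + w) := by
  let A : (Euc n × L.toLinearMap.ker) ≃ₗ[ℝ] Euc d :=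
    { toFun := fun x => R x.1 + x.2
      map_add' := fun x y => by simp; abel
      map_smul' := fun t x => by simp
      invFun := fun x => (L x, ⟨x - R (L x), by simp [hLR]⟩)
      left_inv := fun x => by
        have hx : L (x.2 : Euc d) = 0 := x.2.2
        ext1
        · simp [hLR, hx]
        · ext1; simp [hLR, hx]
      right_inv := fun x => by simp }
  have hA : Measurable A := A.toContinuousLinearEquiv.continuous.measurable
  -- The transported product measure is a Haar measure, hence a multiple of Lebesgue measure; the
  -- value of the factor never matters.
  let μ : Measure (Euc d) := ((volume : Measure (Euc n)).prod volume).map A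
  have : μ.IsAddHaarMeasure := A.toContinuousLinearEquiv.isAddHaarMeasure_map _
  let c := Measure.addHaarScalarFactor (volume : Measure (Euc d)) μ
  have hc : 0 < c := Measure.addHaarScalarFactor_pos_of_isAddHaarMeasure _ _
  have hvol : (volume : Measure (Euc d)) = c • μ := Measure.isAddLeftInvariant_eq_smul _ _
  refine ⟨c, hc, fun g hg => ?_⟩
  have h1 : ∫⁻ x, g x ∂μ = ∫⁻ z : Euc n, ∫⁻ w : L.toLinearMap.ker, g (R z + w) := by
    rw [lintegral_map hg hA, lintegral_prod (fun x => g (A x)) (hg.comp hA).aemeasurable]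
    rfl
  rw [← h1, hvol, lintegral_smul_measure]
  simp [ENNReal.smul_def]

/-- Lebesgue measure with a suitable continuous density, positive at a given regular point of `ξ`,
disintegrates continuously along the level sets of `ξ`. -/
lemma exists_local_disintegration {d n : ℕ} {ξ : Euc d → Euc n} (hξ : ContDiff ℝ ∞ ξ) (q₀ : Euc d)
    (hs : Function.Surjective (fderiv ℝ ξ q₀)) :
    ∃ (m : ProbabilityTheory.Kernel (Euc n) (Euc d)) (ψ : Euc d → ℝ),
      ProbabilityTheory.IsFiniteKernel m ∧ Continuous ψ ∧ HasCompactSupport ψ ∧ (∀ q, 0 ≤ ψ q) ∧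
      0 < ψ q₀ ∧ (∀ z, m z {q | ξ q ≠ z} = 0) ∧
      (∀ A, MeasurableSet A → ∫⁻ z, m z A = ∫⁻ q in A, ENNReal.ofReal (ψ q)) ∧
      (∀ φ : Euc d → ℝ, Continuous φ → Continuous fun z => ∫ q, φ q ∂(m z)) ∧
      ∀ q, 0 < ψ q → m (ξ q) ≠ 0 := by
  set L := fderiv ℝ ξ q₀ with hL
  obtain ⟨R, hR⟩ : ∃ R : Euc n →L[ℝ] Euc d, ∀ z, L (R z) = z := by
    obtain ⟨R, hR⟩ := L.toLinearMap.exists_rightInverse_of_surjective (LinearMap.range_eq_top.2 hs)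
    exact ⟨R.toContinuousLinearMap, fun z => by simpa using LinearMap.congr_fun hR z⟩
  obtain ⟨c, hc, hfib⟩ := exists_lintegral_eq_lintegral_fibre L R hR
  set a := ξ q₀ - L q₀ with ha
  -- the map `Ψ` straightens the level sets
  let Ψ : Euc d → Euc d := fun q => q + R (ξ q - ξ q₀ - L (q - q₀))
  have hΨ : ContDiff ℝ ∞ Ψ := by fun_prop
  -- In the coordinate `Ψ q` the map `ξ` is `L` up to a translation, so its level sets lie in affine
  -- fibres of `L`.
  have hLΨ : ∀ q, L (Ψ q) = ξ q - a := fun q => by simp [Ψ, hR, ha]; abel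
  -- The correction term has zero derivative at `q₀`, so the inverse function theorem applies to
  -- `Ψ`.
  have hΨ' : HasFDerivAt Ψ ((ContinuousLinearEquiv.refl ℝ (Euc d) : Euc d →L[ℝ] Euc d)) q₀ := by
    have h1 : HasFDerivAt ξ L q₀ := (hξ.differentiable (by simp)).differentiableAt.hasFDerivAt
    have h2 := (hasFDerivAt_id q₀).add (R.hasFDerivAt.comp q₀ ((h1.sub_const (ξ q₀)).sub
      (L.hasFDerivAt.comp q₀ ((hasFDerivAt_id q₀).sub_const q₀))))
    refine h2.congr_fderiv ?_
    ext1 x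
    simp
  let e := hΨ.contDiffAt.toOpenPartialHomeomorph Ψ hΨ' (by simp)
  have heΨ : ∀ q, e q = Ψ q := fun q => rfl
  have hq₀ : q₀ ∈ e.source := hΨ.contDiffAt.mem_toOpenPartialHomeomorph_source hΨ' (by simp)
  obtain ⟨ρ, hρ, hball⟩ := Metric.nhds_basis_closedBall.mem_iff.1 (e.open_source.mem_nhds hq₀)
  let θ : Euc d → ℝ := fun q => max 0 (ρ - dist q q₀)
  have hθ : Continuous θ := by fun_prop
  have hθ0 : ∀ q, 0 ≤ θ q := fun q => le_max_left _ _
  have hθpos : ∀ q, 0 < θ q → q ∈ Metric.closedBall q₀ ρ := fun q hq => by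
    rw [Metric.mem_closedBall]
    by_contra hlt
    rw [not_le] at hlt
    simp only [θ, lt_max_iff, lt_irrefl, false_or] at hq
    linarith
  have hθzero : ∀ q, q ∉ Metric.closedBall q₀ ρ → θ q = 0 := fun q hq =>
    le_antisymm (not_lt.1 fun h => hq (hθpos q h)) (hθ0 q)
  -- The fibre measures carry the transported bump `h`, with no Jacobian, so changing variables back
  -- gives the density `θ * J`.
  let J : Euc d → ℝ := fun q => |(fderiv ℝ Ψ q).det|
  have hJ : Continuous J :=
    (ContinuousLinearMap.continuous_det.comp (hΨ.continuous_fderiv (by simp))).abs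
  -- the inverse of `Ψ` and the transported bump function
  have htgt : MeasurableSet e.target := e.open_target.measurableSet
  classical
  -- The value outside `e.target` is harmless: `T` is always weighted by `h`, which vanishes there.
  let T : Euc d → Euc d := e.target.piecewise e.symm (fun _ => q₀)
  have hT : Measurable T :=
    ContinuousOn.measurable_piecewise e.continuousOn_symm continuousOn_const htgt
  have hTmem : ∀ x ∈ e.target, T x = e.symm x := fun x hx => Set.piecewise_eq_of_mem _ _ _ hx
  have hTΨ : ∀ q ∈ e.source, T (Ψ q) = q := fun q hq => by
    exact (hTmem _ (e.map_source hq)).trans (e.left_inv hq)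
  have hmaps : ∀ q ∈ e.source, Ψ q ∈ e.target := fun q hq => e.map_source hq
  let h : Euc d → ℝ := e.target.indicator fun x => θ (T x)
  have hh0 : ∀ x, 0 ≤ h x := fun x => Set.indicator_nonneg (fun _ _ => hθ0 _) _
  let S : Set (Euc d) := Ψ '' Metric.closedBall q₀ ρ
  have hS : IsCompact S := (isCompact_closedBall _ _).image hΨ.continuous
  have hhS : ∀ x, x ∉ S → h x = 0 := fun x hx => by
    by_cases hxt : x ∈ e.target
    · simp only [h, Set.indicator_of_mem hxt, hTmem x hxt]
      refine hθzero _ fun hmem => hx ⟨_, hmem, e.right_inv hxt⟩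
    · exact Set.indicator_of_notMem hxt _
  have hSt : S ⊆ e.target := by
    rintro _ ⟨q, hq, rfl⟩
    exact e.map_source (hball hq)
  have hcont : ∀ φ : Euc d → ℝ, Continuous φ → Continuous fun x => h x * φ (T x) := by
    intro φ hφ
    -- The open sets `e.target` and the complement of the compact `S ⊆ e.target` cover the space,
    -- and the function is zero on the second.
    refine continuous_iff_continuousAt.2 fun x => ?_
    by_cases hx : x ∈ e.target
    · have h1 : ContinuousOn (fun x => θ (e.symm x) * φ (e.symm x)) e.target :=
        (hθ.comp_continuousOn e.continuousOn_symm).mul (hφ.comp_continuousOn e.continuousOn_symm)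
      refine (h1.continuousAt (e.open_target.mem_nhds hx)).congr ?_
      filter_upwards [e.open_target.mem_nhds hx] with y hy
      simp only [h, Set.indicator_of_mem hy, hTmem y hy]
    · refine continuousAt_const.congr (f := fun _ => (0 : ℝ)) ?_
      filter_upwards [hS.isClosed.isOpen_compl.mem_nhds fun hxS => hx (hSt hxS)] with y hy
      rw [hhS y hy, zero_mul]
  have hhc : Continuous h := by simpa using hcont (fun _ => 1) continuous_const
  have hhm : Measurable h := hhc.measurable
  -- the fibre measures
  let sh : Euc n → L.toLinearMap.ker → Euc d := fun z w => R (z - a) + w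
  have hshc : Continuous (Function.uncurry sh) := by
    simp only [sh, Function.uncurry_def]; fun_prop
  have hsh : ∀ z, Measurable (sh z) := fun z =>
    (hshc.comp (Continuous.prodMk_right z)).measurable
  have hdm : ∀ z, Measurable fun w => ENNReal.ofReal (c * h (sh z w)) := fun z =>
    ((hhm.comp (hsh z)).const_mul c).ennreal_ofReal
  -- For fixed `z` the points `sh z w` sweep the fibre `L x = z - a`; `T` carries its part in
  -- `e.target` into `{ξ = z}`.
  let m' : Euc n → Measure (Euc d) := fun z =>
    ((volume : Measure L.toLinearMap.ker).withDensity
      fun w => ENNReal.ofReal (c * h (sh z w))).map fun w => T (sh z w)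
  have hm'l : ∀ z (g : Euc d → ENNReal), Measurable g →
      ∫⁻ q, g q ∂(m' z) = ∫⁻ w, ENNReal.ofReal (c * h (sh z w)) * g (T (sh z w)) := by
    intro z g hg
    have hTs : Measurable fun w => T (sh z w) := hT.comp (hsh z)
    have hgT : Measurable fun w => g (T (sh z w)) := hg.comp hTs
    rw [lintegral_map hg hTs,
      lintegral_withDensity_eq_lintegral_mul _ (hdm z) hgT]
    rfl
  have hm'A : ∀ z (A : Set (Euc d)), MeasurableSet A →
      m' z A = ∫⁻ w, ENNReal.ofReal (c * h (sh z w)) * A.indicator 1 (T (sh z w)) := by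
    intro z A hA
    rw [← hm'l z _ (measurable_one.indicator hA), lintegral_indicator_one hA]
  have hm' : Measurable m' := by
    refine Measure.measurable_of_measurable_coe _ fun A hA => ?_
    simp_rw [hm'A _ A hA]
    refine Measurable.lintegral_prod_right'
      (f := fun x : Euc n × L.toLinearMap.ker =>
        ENNReal.ofReal (c * h (sh x.1 x.2)) * A.indicator 1 (T (sh x.1 x.2))) ?_
    exact ((hhm.comp hshc.measurable).const_mul c).ennreal_ofReal.mul
      ((measurable_one.indicator hA).comp (hT.comp hshc.measurable))
  let m : ProbabilityTheory.Kernel (Euc n) (Euc d) := ⟨m', hm'⟩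
  have hmm' : ∀ z, m z = m' z := fun z => rfl
  have hint : ∀ φ : Euc d → ℝ, Continuous φ → ∀ z,
      ∫ q, φ q ∂(m z) = ∫ w, c * (h (sh z w) * φ (T (sh z w))) := by
    intro φ hφ z
    have hTs : Measurable fun w => T (sh z w) := hT.comp (hsh z)
    rw [hmm', integral_map hTs.aemeasurable hφ.aestronglyMeasurable,
      integral_withDensity_eq_integral_toReal_smul (hdm z) (by simp)]
    refine integral_congr_ae (Eventually.of_forall fun w => ?_)
    simp only [smul_eq_mul]
    rw [ENNReal.toReal_ofReal (mul_nonneg hc.le (hh0 _)), mul_assoc]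
  -- The compact set for `w` does not depend on `z`, which gives continuity of the fibre integrals;
  -- the one for `z` bounds the total masses.
  have hsupp : ∀ z w, h (sh z w) ≠ 0 → z ∈ (fun x => L x + a) '' S ∧
      w ∈ (fun x : Euc d => (⟨x - R (L x), by simp [hR]⟩ : L.toLinearMap.ker)) '' S := by
    intro z w hzw
    have hmem : sh z w ∈ S := by by_contra hn; exact hzw (hhS _ hn)
    have hw : L (w : Euc d) = 0 := w.2
    refine ⟨⟨_, hmem, by simp [sh, hR, hw]⟩, ⟨_, hmem, ?_⟩⟩
    ext1
    simp [sh, hR, hw]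
  have hK1 : IsCompact ((fun x => L x + a) '' S) := hS.image (by fun_prop)
  have hK2 : IsCompact
      ((fun x : Euc d => (⟨x - R (L x), by simp [hR]⟩ : L.toLinearMap.ker)) '' S) :=
    hS.image (Continuous.subtype_mk (by fun_prop) _)
  have hmcont : ∀ φ : Euc d → ℝ, Continuous φ → Continuous fun z => ∫ q, φ q ∂(m z) := by
    intro φ hφ
    simp_rw [hint φ hφ, ← continuousOn_univ]
    refine continuousOn_integral_of_compact_support hK2 ?_ ?_
    · exact (((hcont φ hφ).comp hshc).const_mul c).continuousOn
    · intro z w _ hw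
      have : h (sh z w) = 0 := by by_contra hn; exact hw (hsupp z w hn).2
      simp [this]
  have hmass : ∀ z, m z univ = ENNReal.ofReal (∫ w, c * (h (sh z w) * 1)) := by
    intro z
    rw [hmm', hm'A z univ MeasurableSet.univ, ofReal_integral_eq_lintegral_ofReal]
    · simp
    · refine Continuous.integrable_of_hasCompactSupport ?_ (HasCompactSupport.intro hK2 ?_)
      · have := hhc.comp (hshc.comp (Continuous.prodMk_right z))
        simp only [mul_one]
        exact this.const_mul c
      · intro w hw
        have : h (sh z w) = 0 := by by_contra hn; exact hw (hsupp z w hn).2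
        simp [this]
    · exact Eventually.of_forall fun w => mul_nonneg hc.le (mul_nonneg (hh0 _) zero_le_one)
  refine ⟨m, fun q => θ q * J q, ?_, hθ.mul hJ, ?_, fun q => mul_nonneg (hθ0 q) (abs_nonneg _),
    ?_, ?_, ?_, hmcont, ?_⟩
  · -- the total masses are bounded
    have hc1 := hmcont (fun _ => 1) continuous_const
    simp_rw [hint (fun _ => 1) continuous_const] at hc1
    have hcs : HasCompactSupport fun z => ∫ w, c * (h (sh z w) * 1) := by
      refine HasCompactSupport.intro hK1 fun z hz => ?_
      refine integral_eq_zero_of_ae (Eventually.of_forall fun w => ?_)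
      have : h (sh z w) = 0 := by by_contra hn; exact hz (hsupp z w hn).1
      simp [this]
    obtain ⟨C, hC⟩ := hc1.bounded_above_of_compact_support hcs
    refine ⟨⟨ENNReal.ofReal C, ENNReal.ofReal_lt_top, fun z => ?_⟩⟩
    rw [hmass]
    exact ENNReal.ofReal_le_ofReal ((le_abs_self _).trans (hC z))
  · exact HasCompactSupport.intro (isCompact_closedBall q₀ ρ) fun q hq => by
      simp [hθzero q hq]
  · have : J q₀ = 1 := by
      simp only [J, hΨ'.fderiv]
      simp [ContinuousLinearMap.det]
    simpa [this, θ] using hρ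
  · intro z
    have hAm : MeasurableSet {q | ξ q ≠ z} :=
      (isOpen_ne_fun hξ.continuous continuous_const).measurableSet
    rw [hmm', hm'A z _ hAm, lintegral_eq_zero_iff' (by
      exact ((hdm z).mul ((measurable_one.indicator hAm).comp (hT.comp (hsh z)))).aemeasurable)]
    refine Eventually.of_forall fun w => ?_
    by_cases hx : sh z w ∈ e.target
    · have h1 : ξ (T (sh z w)) = z := by
        have hw : L (w : Euc d) = 0 := w.2
        have h2 := hLΨ (e.symm (sh z w))
        have h3 : Ψ (e.symm (sh z w)) = sh z w := e.right_inv hx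
        rw [h3] at h2
        simp only [sh, map_add, hR, hw, add_zero] at h2
        rw [hTmem _ hx]
        exact (sub_left_injective h2).symm
      simp [h1]
    · have : h (sh z w) = 0 := Set.indicator_of_notMem hx _
      simp [this]
  · intro A hA
    have hgm : Measurable fun x => ENNReal.ofReal (h x) * A.indicator 1 (T x) :=
      hhm.ennreal_ofReal.mul ((measurable_one.indicator hA).comp hT)
    have h1 : ∫⁻ z, m z A
        = ∫⁻ z, ENNReal.ofReal c * ∫⁻ w : L.toLinearMap.ker,
          (fun x => ENNReal.ofReal (h x) * A.indicator 1 (T x)) (R (z - a) + w) := by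
      refine lintegral_congr fun z => ?_
      have hgs : Measurable fun w => ENNReal.ofReal (h (sh z w)) * A.indicator 1 (T (sh z w)) :=
        hgm.comp (hsh z)
      refine Eq.trans ?_ (lintegral_const_mul (ENNReal.ofReal c) hgs)
      rw [hmm', hm'A z A hA]
      refine lintegral_congr fun w => ?_
      rw [ENNReal.ofReal_mul hc.le, mul_assoc]
    -- Translation invariance absorbs the shift by `a`, so that the linear fibre formula applies.
    rw [h1, lintegral_sub_right_eq_self (fun z => ENNReal.ofReal c * ∫⁻ w : L.toLinearMap.ker,
          (fun x => ENNReal.ofReal (h x) * A.indicator 1 (T x)) (R z + w)) a,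
      lintegral_const_mul' _ _ ENNReal.ofReal_ne_top, ← hfib _ hgm]
    have h2 : ∫⁻ x, ENNReal.ofReal (h x) * A.indicator 1 (T x)
        = ∫⁻ x in e.target, ENNReal.ofReal (h x) * A.indicator 1 (T x) := by
      rw [← lintegral_indicator htgt]
      refine lintegral_congr fun x => ?_
      by_cases hx : x ∈ e.target
      · rw [Set.indicator_of_mem hx]
      · rw [Set.indicator_of_notMem hx]
        have : h x = 0 := Set.indicator_of_notMem hx _
        simp [this]
    have himg : e.target = Ψ '' e.source := e.image_source_eq_target.symm
    have hcv := lintegral_image_eq_lintegral_abs_det_fderiv_mul volume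
      e.open_source.measurableSet
      (fun x _ => (hΨ.differentiable (by simp)).differentiableAt.hasFDerivAt.hasFDerivWithinAt)
      (f := Ψ) e.injOn (fun x => ENNReal.ofReal (h x) * A.indicator 1 (T x))
    rw [h2, himg, hcv, ← lintegral_indicator e.open_source.measurableSet, ← lintegral_indicator hA]
    refine lintegral_congr fun q => ?_
    by_cases hq : q ∈ e.source
    · have h3 : h (Ψ q) = θ q := by
        simp only [h]
        rw [Set.indicator_of_mem (hmaps q hq), hTΨ q hq]
      rw [Set.indicator_of_mem hq, h3, hTΨ q hq]
      by_cases hqA : q ∈ A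
      · simp only [Set.indicator_of_mem hqA, Pi.one_apply, mul_one]
        rw [mul_comm, ENNReal.ofReal_mul (hθ0 q)]
      · simp [hqA]
    · have : θ q = 0 := hθzero q fun hmem => hq (hball hmem)
      rw [Set.indicator_of_notMem hq]
      simp [Set.indicator_apply, this]
  · intro q hq hzero
    have hθq : 0 < θ q := by
      rcases (hθ0 q).lt_or_eq with h1 | h1
      · exact h1
      · simp [← h1] at hq
    have hqs : q ∈ e.source := hball (hθpos q hθq)
    have h3 : h (Ψ q) = θ q := by
      simp only [h]
      rw [Set.indicator_of_mem (hmaps q hqs), hTΨ q hqs]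
    have hz := hmass (ξ q)
    rw [hzero] at hz
    simp only [Measure.coe_zero, Pi.zero_apply, mul_one] at hz
    have hcc : Continuous fun w => c * h (sh (ξ q) w) :=
      (hhc.comp (hshc.comp (Continuous.prodMk_right (ξ q)))).const_mul c
    -- The witness is the kernel component of `Ψ q`: there `sh (ξ q)` takes the value `Ψ q`, and `h
    -- (Ψ q) = θ q > 0`.
    have hpos : 0 < ∫ w, c * h (sh (ξ q) w) := by
      refine hcc.integral_pos_of_hasCompactSupport_nonneg_nonzero
        (HasCompactSupport.intro hK2 ?_) (fun w => mul_nonneg hc.le (hh0 _))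
        (x := ⟨Ψ q - R (ξ q - a), by simp [hR, hLΨ]⟩) ?_
      · intro w hw
        have : h (sh (ξ q) w) = 0 := by by_contra hn; exact hw (hsupp _ w hn).2
        simp [this]
      · simp only [sh, add_sub_cancel, h3]
        exact (mul_pos hc hθq).ne'
    exact (ENNReal.ofReal_pos.2 hpos).ne hz

/-- The conditional measures exist, and they do not vanish on nonempty level sets. -/
lemma exists_isConditionalMeasure {d n : ℕ} {ξ : Euc d → Euc n} (hξ : ContDiff ℝ ∞ ξ) {r : ℝ}
    (hreg : ∀ q, ‖ξ q‖ < r → Function.Surjective (fderiv ℝ ξ q)) (hne : ∃ q, ‖ξ q‖ < r) :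
    ∃ κ : ProbabilityTheory.Kernel (Euc n) (Euc d), IsConditionalMeasure ξ r κ ∧
      ∀ q, ‖ξ q‖ < r → κ (ξ q) ≠ 0 := by
  have hξc := hξ.continuous
  let Ω : Set (Euc d) := {q | ‖ξ q‖ < r}
  have hΩ : IsOpen Ω := isOpen_lt (by fun_prop) continuous_const
  choose m₀ ψ₀ h₀ using fun q : Ω => exists_local_disintegration hξ (q : Euc d) (hreg q q.2)
  -- By the Lindelöf property countably many local densities are enough to have a positive one at
  -- each point of `Ω`.
  obtain ⟨t, htc, htU⟩ := TopologicalSpace.isOpen_iUnion_countable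
    (fun q : Ω => {x | 0 < ψ₀ q x}) fun q => isOpen_lt continuous_const (h₀ q).2.1
  have hcov₀ : ∀ q : Ω, ∃ i ∈ t, 0 < ψ₀ i q := by
    intro q
    have : (q : Euc d) ∈ ⋃ i ∈ t, {x | 0 < ψ₀ i x} := by
      rw [htU]
      exact mem_iUnion.2 ⟨q, (h₀ q).2.2.2.2.1⟩
    simpa using this
  obtain ⟨qne, hqne⟩ := hne
  have htne : t.Nonempty := by
    obtain ⟨i, hi, -⟩ := hcov₀ ⟨qne, hqne⟩
    exact ⟨i, hi⟩
  obtain ⟨idx, hidx⟩ := htc.exists_eq_range htne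
  have hcov : ∀ q ∈ Ω, ∃ i : ℕ, 0 < ψ₀ (idx i) q := by
    intro q hq
    obtain ⟨i, hi, hpos⟩ := hcov₀ ⟨q, hq⟩
    rw [hidx] at hi
    obtain ⟨k, rfl⟩ := hi
    exact ⟨k, hpos⟩
  let m : ℕ → ProbabilityTheory.Kernel (Euc n) (Euc d) := fun i => m₀ (idx i)
  let ψ : ℕ → Euc d → ℝ := fun i => ψ₀ (idx i)
  have hfin : ∀ i, ProbabilityTheory.IsFiniteKernel (m i) := fun i => (h₀ (idx i)).1
  have hψc : ∀ i, Continuous (ψ i) := fun i => (h₀ (idx i)).2.1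
  have hψ0 : ∀ i q, 0 ≤ ψ i q := fun i => (h₀ (idx i)).2.2.2.1
  have hcar : ∀ i z, m i z {q | ξ q ≠ z} = 0 := fun i => (h₀ (idx i)).2.2.2.2.2.1
  have hdis : ∀ i A, MeasurableSet A → ∫⁻ z, m i z A = ∫⁻ q in A, ENNReal.ofReal (ψ i q) :=
    fun i => (h₀ (idx i)).2.2.2.2.2.2.1
  have hmc : ∀ i (φ : Euc d → ℝ), Continuous φ → Continuous fun z => ∫ q, φ q ∂(m i z) :=
    fun i => (h₀ (idx i)).2.2.2.2.2.2.2.1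
  have hmne : ∀ i q, 0 < ψ i q → m i (ξ q) ≠ 0 := fun i => (h₀ (idx i)).2.2.2.2.2.2.2.2
  have hcarae : ∀ i z, ∀ᵐ q ∂(m i z), ξ q = z := fun i z => by
    rw [ae_iff]; exact hcar i z
  -- weights making the sums converge uniformly
  choose D hD using fun i => (hψc i).bounded_above_of_compact_support (h₀ (idx i)).2.2.1
  have hmassfin : ∀ i, ∃ C : ℝ, 0 ≤ C ∧ ∀ z, m i z univ ≤ ENNReal.ofReal C := fun i =>
    ⟨(m i).bound.toReal, ENNReal.toReal_nonneg, fun z => by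
      rw [ENNReal.ofReal_toReal (m i).bound_ne_top]
      exact (m i).measure_le_bound z univ⟩
  choose C hC0 hC using hmassfin
  have hD0 : ∀ i, 0 ≤ D i := fun i => (norm_nonneg _).trans (hD i 0)
  have hden : ∀ i, 0 < 1 + C i + D i := fun i => by linarith [hC0 i, hD0 i]
  let a : ℕ → ℝ := fun i => (1 / 2) ^ i / (1 + C i + D i)
  have ha : ∀ i, 0 < a i := fun i => div_pos (by positivity) (hden i)
  -- Used with `x = ψ i q` and with `x = C i`: the same weights control the densities and the fibre
  -- masses.
  have hbd : ∀ i x, x ≤ 1 + C i + D i → a i * x ≤ (1 / 2) ^ i := fun i x hx => by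
    have : a i * (1 + C i + D i) = (1 / 2) ^ i := div_mul_cancel₀ _ (hden i).ne'
    rw [← this]
    exact mul_le_mul_of_nonneg_left hx (ha i).le
  have hgeo : Summable fun i : ℕ => ((1 : ℝ) / 2) ^ i := summable_geometric_two
  let S : Euc d → ℝ := fun q => ∑' i, a i * ψ i q
  have hSbd : ∀ i q, ‖a i * ψ i q‖ ≤ (1 / 2) ^ i := fun i q => by
    rw [Real.norm_of_nonneg (mul_nonneg (ha i).le (hψ0 i q))]
    refine hbd i _ ?_
    linarith [(le_abs_self _).trans (hD i q), hC0 i]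
  have hSs : ∀ q, Summable fun i => a i * ψ i q := fun q =>
    Summable.of_norm_bounded hgeo fun i => hSbd i q
  have hSc : Continuous S := continuous_tsum (fun i => (hψc i).const_mul (a i)) hgeo hSbd
  have hSm : Measurable S := hSc.measurable
  have hS0 : ∀ q, 0 ≤ S q := fun q => tsum_nonneg fun i => mul_nonneg (ha i).le (hψ0 i q)
  have hSpos : ∀ q ∈ Ω, 0 < S q := fun q hq => by
    obtain ⟨i, hi⟩ := hcov q hq
    exact (hSs q).tsum_pos (fun i => mul_nonneg (ha i).le (hψ0 i q)) i (mul_pos (ha i) hi)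
  -- After division by `S` the densities `a i * ψ i / S` sum to one on `Ω`. Where `S` vanishes the
  -- quotient is zero by convention, but this happens only outside `Ω`.
  let κi : ℕ → ProbabilityTheory.Kernel (Euc n) (Euc d) := fun i =>
    (m i).withDensity fun _ q => ENNReal.ofReal (a i / S q)
  have hwm : ∀ i, Measurable fun q => ENNReal.ofReal (a i / S q) := fun i =>
    (hSm.const_div (a i)).ennreal_ofReal
  have hwm' : ∀ i, Measurable (Function.uncurry fun (_ : Euc n) q => ENNReal.ofReal (a i / S q)) :=
    fun i => (hwm i).comp measurable_snd
  have hκi : ∀ i z, κi i z = (m i z).withDensity fun q => ENNReal.ofReal (a i / S q) := fun i z =>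
    ProbabilityTheory.Kernel.withDensity_apply _ (hwm' i) z
  let κ : ProbabilityTheory.Kernel (Euc n) (Euc d) := ProbabilityTheory.Kernel.sum κi
  have hκ : ∀ z, κ z = Measure.sum fun i => κi i z := fun z =>
    ProbabilityTheory.Kernel.sum_apply κi z
  have hκcar : ∀ z, κ z {q | ξ q ≠ z} = 0 := by
    intro z
    rw [hκ, Measure.sum_apply_eq_zero]
    intro i
    rw [hκi]
    exact withDensity_absolutelyContinuous _ _ (hcar i z)
  have hκlf : ∀ z, ‖z‖ < r → IsLocallyFiniteMeasure (κ z) := by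
    intro z hz
    refine ⟨fun q => ?_⟩
    by_cases hq : ξ q = z
    · have hqΩ : q ∈ Ω := by simpa [Ω, hq] using hz
      -- On the neighbourhood where `S` exceeds half its value at `q`, the factors `a i / S` are at
      -- most `2 * a i / S q`, so the masses are summable.
      have hs := hSpos q hqΩ
      let N : Set (Euc d) := {x | S q / 2 < S x}
      have hN : IsOpen N := isOpen_lt continuous_const hSc
      refine ⟨N, hN.mem_nhds (by simp only [N, mem_ofPred_eq]; linarith), ?_⟩
      rw [hκ, Measure.sum_apply _ hN.measurableSet]
      refine lt_of_le_of_lt (ENNReal.tsum_le_tsum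
        (g := fun i => ENNReal.ofReal (2 / S q * (1 / 2) ^ i)) fun i => ?_) ?_
      · rw [hκi, withDensity_apply _ hN.measurableSet]
        calc ∫⁻ x in N, ENNReal.ofReal (a i / S x) ∂(m i z)
            ≤ ∫⁻ _ in N, ENNReal.ofReal (a i / (S q / 2)) ∂(m i z) := by
              refine setLIntegral_mono measurable_const fun x hx => ENNReal.ofReal_le_ofReal ?_
              exact div_le_div_of_nonneg_left (ha i).le (by linarith) (le_of_lt hx)
          _ ≤ ENNReal.ofReal (a i / (S q / 2)) * ENNReal.ofReal (C i) := by
              rw [setLIntegral_const]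
              gcongr
              exact (measure_mono (subset_univ _)).trans (hC i z)
          _ ≤ ENNReal.ofReal (2 / S q * (1 / 2) ^ i) := by
              rw [← ENNReal.ofReal_mul (div_nonneg (ha i).le (by linarith))]
              refine ENNReal.ofReal_le_ofReal ?_
              have h1 := hbd i (C i) (by linarith [hD0 i])
              calc a i / (S q / 2) * C i = 2 / S q * (a i * C i) := by field_simp
                _ ≤ _ := mul_le_mul_of_nonneg_left h1 (by positivity)
      · rw [← ENNReal.ofReal_tsum_of_nonneg (fun i => by positivity) (hgeo.mul_left _)]
        exact ENNReal.ofReal_lt_top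
    · refine ⟨{x | ξ x ≠ z}, (isOpen_ne_fun hξc continuous_const).mem_nhds hq, ?_⟩
      rw [hκcar]
      exact ENNReal.zero_lt_top
  refine ⟨κ, ⟨hκlf, fun z _ => hκcar z, ?_, ?_⟩, ?_⟩
  · -- chain rule
    intro A hA
    have hbind : ∀ i (g : Euc d → ENNReal), Measurable g →
        ∫⁻ z, ∫⁻ q, g q ∂(m i z) = ∫⁻ q, ENNReal.ofReal (ψ i q) * g q := by
      intro i g hg
      have h1 : (volume : Measure (Euc n)).bind (m i)
          = volume.withDensity fun q => ENNReal.ofReal (ψ i q) := by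
        ext B hB
        rw [Measure.bind_apply hB (m i).measurable.aemeasurable, hdis i B hB,
          withDensity_apply _ hB]
      rw [← Measure.lintegral_bind (m i).measurable.aemeasurable hg.aemeasurable, h1,
        lintegral_withDensity_eq_lintegral_mul _ (hψc i).measurable.ennreal_ofReal hg]
      rfl
    have hAΩ : MeasurableSet (A ∩ Ω) := hA.inter hΩ.measurableSet
    have h1 : ∀ z, (Metric.ball (0 : Euc n) r).indicator (fun z => κ z A) z
        = ∑' i, ∫⁻ q, (A ∩ Ω).indicator (fun q => ENNReal.ofReal (a i / S q)) q ∂(m i z) := by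
      intro z
      by_cases hz : z ∈ Metric.ball (0 : Euc n) r
      · rw [Set.indicator_of_mem hz, hκ, Measure.sum_apply _ hA]
        refine tsum_congr fun i => ?_
        rw [hκi, withDensity_apply _ hA, ← lintegral_indicator hA]
        refine lintegral_congr_ae ?_
        filter_upwards [hcarae i z] with q hq
        have hqΩ : q ∈ Ω := by simpa [Ω, hq] using hz
        by_cases hqA : q ∈ A
        · rw [Set.indicator_of_mem hqA, Set.indicator_of_mem (s := A ∩ Ω) ⟨hqA, hqΩ⟩]
        · rw [Set.indicator_of_notMem hqA, Set.indicator_of_notMem (s := A ∩ Ω) fun h => hqA h.1]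
      · rw [Set.indicator_of_notMem hz]
        refine (ENNReal.tsum_eq_zero.2 fun i => ?_).symm
        refine (lintegral_congr_ae ?_).trans lintegral_zero
        filter_upwards [hcarae i z] with q hq
        refine Set.indicator_of_notMem (fun hmem => hz ?_) _
        simpa [Ω, hq] using hmem.2
    rw [← lintegral_indicator Metric.isOpen_ball.measurableSet, lintegral_congr h1,
      lintegral_tsum fun i => (((hwm i).indicator hAΩ).lintegral_kernel).aemeasurable]
    simp_rw [hbind _ _ ((hwm _).indicator hAΩ)]
    refine Eq.trans ?_ (lintegral_tsum fun i =>
      ((hψc i).measurable.ennreal_ofReal.mul ((hwm i).indicator hAΩ)).aemeasurable)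
    refine (lintegral_indicator_one hAΩ).symm.trans (lintegral_congr fun q => ?_)
    by_cases hq : q ∈ A ∩ Ω
    · have hs := hSpos q hq.2
      simp only [Set.indicator_of_mem hq, Pi.one_apply]
      have h2 : ∀ i, ENNReal.ofReal (ψ i q) * ENNReal.ofReal (a i / S q)
          = ENNReal.ofReal (a i * ψ i q / S q) := fun i => by
        rw [← ENNReal.ofReal_mul (hψ0 i q)]
        congr 1
        ring
      simp_rw [h2]
      rw [← ENNReal.ofReal_tsum_of_nonneg
        (fun i => div_nonneg (mul_nonneg (ha i).le (hψ0 i q)) hs.le) ((hSs q).div_const _),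
        tsum_div_const]
      change 1 = ENNReal.ofReal (S q / S q)
      rw [div_self hs.ne', ENNReal.ofReal_one]
    · simp [Set.indicator_of_notMem hq]
  · -- continuity
    intro φ hφ hφs
    refine continuousOn_of_forall_continuousAt fun z₀ hz₀ => ?_
    have hz₀' : ‖z₀‖ < r := by simpa using hz₀
    obtain ⟨r', hzr', hr'⟩ := exists_between hz₀'
    -- Since `1 / S` is controlled only on `Ω`, `φ / S` is cut off by `χ ∘ ξ`, whose support stays
    -- inside `Ω`. On `{ξ = z}` this factor is the constant `χ z` and is divided out again below.
    let χ : Euc n → ℝ := fun z => max 0 (r' - ‖z‖)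
    have hχ : Continuous χ := by fun_prop
    let g : Euc d → ℝ := fun q => φ q * χ (ξ q) / S q
    have hg : Continuous g := by
      refine continuous_iff_continuousAt.2 fun q => ?_
      by_cases hq : q ∈ Ω
      · exact ((hφ.mul (hχ.comp hξc)).continuousAt).div hSc.continuousAt (hSpos q hq).ne'
      · have hq' : r' < ‖ξ q‖ := hr'.trans_le (not_lt.1 hq)
        refine continuousAt_const.congr (f := fun _ => (0 : ℝ)) ?_
        filter_upwards [(isOpen_lt continuous_const hξc.norm).mem_nhds hq'] with x hx
        have : χ (ξ x) = 0 := max_eq_left (by linarith [show r' < ‖ξ x‖ from hx])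
        simp [g, this]
    have hgs : HasCompactSupport g := by
      refine HasCompactSupport.intro hφs fun q hq => ?_
      simp [g, image_eq_zero_of_notMem_tsupport hq]
    obtain ⟨B, hB⟩ := hg.bounded_above_of_compact_support hgs
    have hB0 : 0 ≤ B := (norm_nonneg _).trans (hB 0)
    let G : Euc n → ℝ := fun z => ∑' i, a i * ∫ q, g q ∂(m i z)
    have hG : Continuous G := by
      refine continuous_tsum (fun i => (hmc i g hg).const_mul (a i)) (hgeo.mul_left B)
        fun i z => ?_
      have h1 : ‖∫ q, g q ∂(m i z)‖ ≤ B * C i := by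
        refine (norm_integral_le_of_norm_le_const (Eventually.of_forall hB)).trans ?_
        refine mul_le_mul_of_nonneg_left ?_ hB0
        exact ENNReal.toReal_le_of_le_ofReal (hC0 i) (hC i z)
      rw [norm_mul, Real.norm_of_nonneg (ha i).le]
      calc a i * ‖∫ q, g q ∂(m i z)‖ ≤ a i * (B * C i) :=
            mul_le_mul_of_nonneg_left h1 (ha i).le
        _ = B * (a i * C i) := by ring
        _ ≤ B * (1 / 2) ^ i :=
            mul_le_mul_of_nonneg_left (hbd i _ (by linarith [hD0 i])) hB0
    have hGeq : ∀ z, ‖z‖ < r' → G z / χ z = ∫ q, φ q ∂(κ z) := by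
      intro z hz
      have hzr := hz.trans hr'
      have hχz : 0 < χ z := lt_max_of_lt_right (by linarith)
      have := hκlf z hzr
      have hint : Integrable φ (κ z) := hφ.integrable_of_hasCompactSupport hφs
      have hsum := hasSum_integral_measure (hκ z ▸ hint : Integrable φ (Measure.sum fun i => κi i z))
      rw [← hκ] at hsum
      rw [div_eq_iff hχz.ne', ← hsum.tsum_eq, ← tsum_mul_right]
      refine tsum_congr fun i => ?_
      rw [hκi, integral_withDensity_eq_integral_toReal_smul (hwm i) (by simp),
        ← integral_const_mul, ← integral_mul_const]
      refine integral_congr_ae ?_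
      filter_upwards [hcarae i z] with q hq
      simp only [g, smul_eq_mul, hq]
      rw [ENNReal.toReal_ofReal (div_nonneg (ha i).le (hS0 q))]
      ring
    have hχz₀ : χ z₀ ≠ 0 := (lt_max_of_lt_right (by linarith) : 0 < χ z₀).ne'
    refine (hG.continuousAt.div hχ.continuousAt hχz₀).congr ?_
    filter_upwards [(isOpen_lt continuous_norm continuous_const).mem_nhds hzr'] with z hz
    exact hGeq z hz
  · intro q hq hzero
    obtain ⟨i, hi⟩ := hcov q hq
    refine hmne i q hi ?_
    -- If the sum vanished, so would each summand; its density is positive on the level set, which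
    -- would force `m i (ξ q) = 0`.
    have h1 : κi i (ξ q) = 0 := by
      refine le_antisymm ?_ (Measure.zero_le _)
      rw [← hzero, hκ]
      exact Measure.le_sum (fun i => κi i (ξ q)) i
    rw [hκi, withDensity_eq_zero_iff (hwm i).aemeasurable] at h1
    rw [← ae_eq_bot, ← Filter.eventually_false_iff_eq_bot]
    filter_upwards [h1, hcarae i (ξ q)] with x hx hxq
    have hxΩ : x ∈ Ω := by simpa [Ω, hxq] using hq
    have hpos : 0 < ENNReal.ofReal (a i / S x) := ENNReal.ofReal_pos.2 (div_pos (ha i) (hSpos x hxΩ))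
    exact hpos.ne' hx

/-! ### From vague to weak convergence -/

/-- Vague convergence of finite measures together with tightness implies that the limit is finite
and that bounded continuous functions may be integrated in the limit. -/
lemma tendsto_integral_of_vague_of_tight {ι E : Type*} {l : Filter ι} [l.NeBot]
    [NormedAddCommGroup E] [ProperSpace E] [MeasurableSpace E] [BorelSpace E]
    (ν : ι → Measure E) (ν₀ : Measure E) [∀ i, IsFiniteMeasure (ν i)] [IsLocallyFiniteMeasure ν₀]
    (hv : ∀ φ : E → ℝ, Continuous φ → HasCompactSupport φ →
      Tendsto (fun i => ∫ q, φ q ∂(ν i)) l (𝓝 (∫ q, φ q ∂ν₀)))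
    (ht : ∀ η : ℝ, 0 < η → ∃ R : ℝ, ∀ᶠ i in l, (ν i).real {q | R < ‖q‖} ≤ η) :
    IsFiniteMeasure ν₀ ∧ ∀ f : BoundedContinuousFunction E ℝ,
      Tendsto (fun i => ∫ q, f q ∂(ν i)) l (𝓝 (∫ q, f q ∂ν₀)) := by
  let χ : ℝ → E → ℝ := fun R q => max 0 (min 1 (R + 1 - ‖q‖))
  have hχc : ∀ R, Continuous (χ R) := fun R => by fun_prop
  have hχ0 : ∀ R q, 0 ≤ χ R q := fun R q => le_max_left _ _
  have hχ1 : ∀ R q, χ R q ≤ 1 := fun R q => max_le zero_le_one (min_le_left _ _)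
  have hχin : ∀ R q, ‖q‖ ≤ R → χ R q = 1 := fun R q hq => by
    simp only [χ]
    rw [min_eq_left (by linarith), max_eq_right zero_le_one]
  have hχs : ∀ R, HasCompactSupport (χ R) := fun R => by
    refine HasCompactSupport.intro (isCompact_closedBall (0 : E) (R + 1)) fun q hq => ?_
    simp only [Metric.mem_closedBall, dist_zero_right, not_le] at hq
    exact max_eq_left ((min_le_right _ _).trans (by linarith))
  have hχi : ∀ R (μ : Measure E) [IsLocallyFiniteMeasure μ], Integrable (χ R) μ := fun R μ _ =>
    (hχc R).integrable_of_hasCompactSupport (hχs R)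
  have hset : ∀ R : ℝ, MeasurableSet {q : E | R < ‖q‖} := fun R =>
    (isOpen_lt continuous_const continuous_norm).measurableSet
  have htail : ∀ R i, ∫ q, (1 - χ R q) ∂(ν i) ≤ (ν i).real {q | R < ‖q‖} := fun R i => by
    rw [← integral_indicator_one (hset R)]
    refine integral_mono ((integrable_const 1).sub (hχi R _))
      ((integrable_const (1 : ℝ)).indicator (hset R)) fun q => ?_
    by_cases hq : R < ‖q‖
    · rw [Set.indicator_of_mem (s := {q : E | R < ‖q‖}) hq]
      simpa using hχ0 R q
    · rw [Set.indicator_of_notMem (s := {q : E | R < ‖q‖}) hq]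
      simp [hχin R q (not_lt.1 hq)]
  have hfin : IsFiniteMeasure ν₀ := by
    obtain ⟨R₁, hR₁⟩ := ht 1 one_pos
    -- One unit allows for the error in the vague limit of `χ R₁`, the other for the tail beyond
    -- `R₁`.
    let B := ∫ q, χ R₁ q ∂ν₀ + 2
    have hB : ∀ᶠ i in l, (ν i).real univ ≤ B := by
      have h1 := (hv _ (hχc R₁) (hχs R₁)).eventually_lt_const
        (show ∫ q, χ R₁ q ∂ν₀ < ∫ q, χ R₁ q ∂ν₀ + 1 by linarith)
      filter_upwards [hR₁, h1] with i hi hi1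
      have h2 := htail R₁ i
      rw [integral_sub (integrable_const 1) (hχi R₁ _)] at h2
      simp only [integral_const, smul_eq_mul, mul_one] at h2
      simp only [B]
      linarith
    have hball : ∀ k : ℕ, ν₀ (Metric.closedBall 0 k) ≤ ENNReal.ofReal B := fun k => by
      have h1 : ∫ q, χ k q ∂ν₀ ≤ B := by
        refine le_of_tendsto (hv _ (hχc k) (hχs k)) ?_
        filter_upwards [hB] with i hi
        refine le_trans ?_ hi
        calc ∫ q, χ k q ∂(ν i) ≤ ∫ _, (1 : ℝ) ∂(ν i) :=
              integral_mono (hχi _ _) (integrable_const 1) (hχ1 k)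
          _ = _ := by simp
      have h2 : ν₀.real (Metric.closedBall 0 k) ≤ ∫ q, χ k q ∂ν₀ := by
        rw [← integral_indicator_one Metric.isClosed_closedBall.measurableSet]
        refine integral_mono ?_ (hχi _ _) fun q => ?_
        · refine (integrable_indicator_iff Metric.isClosed_closedBall.measurableSet).2 ?_
          exact integrableOn_const (isCompact_closedBall _ _).measure_lt_top.ne
        · by_cases hq : q ∈ Metric.closedBall (0 : E) k
          · rw [Set.indicator_of_mem hq, hχin _ _ (by simpa using hq)]
            rfl
          · rw [Set.indicator_of_notMem hq]
            exact hχ0 _ _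
      rw [← ENNReal.ofReal_toReal
        (isCompact_closedBall (0 : E) (k : ℝ)).measure_lt_top.ne]
      exact ENNReal.ofReal_le_ofReal (h2.trans h1)
    have hU : (univ : Set E) = ⋃ k : ℕ, Metric.closedBall (0 : E) k :=
      (Metric.iUnion_closedBall_nat 0).symm
    have hmono : Monotone fun k : ℕ => Metric.closedBall (0 : E) k := fun a b hab =>
      Metric.closedBall_subset_closedBall (by exact_mod_cast hab)
    refine ⟨?_⟩
    rw [hU, hmono.measure_iUnion]
    exact (iSup_le hball).trans_lt ENNReal.ofReal_lt_top
  refine ⟨hfin, fun f => ?_⟩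
  have htail₀ : ∀ η R : ℝ, (∀ᶠ i in l, (ν i).real {q | R < ‖q‖} ≤ η) →
      ∫ q, (1 - χ R q) ∂ν₀ ≤ η := by
    intro η R hR
    -- `1 - χ R` is not compactly supported, so the tail bound passes to the limit through `χ k - χ
    -- R` before `k → ∞`.
    have h1 : ∀ k : ℕ, R ≤ k → ∫ q, (χ k q - χ R q) ∂ν₀ ≤ η := by
      intro k hk
      refine le_of_tendsto (hv _ ((hχc k).sub (hχc R)) ((hχs k).sub (hχs R))) ?_
      filter_upwards [hR] with i hi
      refine le_trans (le_trans ?_ (htail R i)) hi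
      refine integral_mono ((hχi _ _).sub (hχi _ _)) ((integrable_const 1).sub (hχi _ _))
        fun q => ?_
      exact sub_le_sub_right (hχ1 _ _) _
    have h2 : Tendsto (fun k : ℕ => ∫ q, (χ k q - χ R q) ∂ν₀) atTop
        (𝓝 (∫ q, (1 - χ R q) ∂ν₀)) := by
      refine tendsto_integral_of_dominated_convergence (fun _ => 1)
        (fun k => ((hχc k).sub (hχc R)).aestronglyMeasurable) (integrable_const 1) ?_ ?_
      · refine fun k => Eventually.of_forall fun q => ?_
        rw [Real.norm_eq_abs, abs_le]
        constructor <;> linarith [hχ0 k q, hχ1 k q, hχ0 R q, hχ1 R q]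
      · refine Eventually.of_forall fun q => ?_
        refine tendsto_const_nhds.congr' ?_
        filter_upwards [eventually_ge_atTop ⌈‖q‖⌉₊] with k hk
        rw [hχin k q ((Nat.le_ceil _).trans (by exact_mod_cast hk))]
    refine le_of_tendsto h2 ?_
    filter_upwards [eventually_ge_atTop ⌈R⌉₊] with k hk
    exact h1 k ((Nat.le_ceil _).trans (by exact_mod_cast hk))
  have hsplit : ∀ R (μ : Measure E) [IsFiniteMeasure μ],
      |∫ q, f q ∂μ - ∫ q, f q * χ R q ∂μ| ≤ ‖f‖ * ∫ q, (1 - χ R q) ∂μ := by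
    intro R μ _
    have hfi : Integrable f μ := f.integrable μ
    have hfχ : Integrable (fun q => f q * χ R q) μ :=
      (f.continuous.mul (hχc R)).integrable_of_hasCompactSupport (hχs R).mul_left
    rw [← integral_sub hfi hfχ, ← integral_const_mul]
    have hI : Integrable (fun q => ‖f‖ * (1 - χ R q)) μ :=
      ((integrable_const 1).sub (hχi R μ)).const_mul ‖f‖
    rw [← Real.norm_eq_abs]
    refine norm_integral_le_of_norm_le hI ?_
    refine Eventually.of_forall fun q => ?_
    have : f q - f q * χ R q = f q * (1 - χ R q) := by ring
    rw [this, norm_mul, Real.norm_of_nonneg (sub_nonneg.2 (hχ1 R q))]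
    exact mul_le_mul_of_nonneg_right (f.norm_coe_le_norm q) (sub_nonneg.2 (hχ1 R q))
  rw [Metric.tendsto_nhds]
  intro δ hδ
  have hf1 : 0 < ‖f‖ + 1 := by linarith [norm_nonneg f]
  -- A third of `δ` for each of the two truncations and one for the vague limit; the `+ 1` covers `f
  -- = 0`.
  obtain ⟨R, hR⟩ := ht (δ / (3 * (‖f‖ + 1))) (by positivity)
  have hsmall : ‖f‖ * (δ / (3 * (‖f‖ + 1))) ≤ δ / 3 := by
    have : δ / 3 = (‖f‖ + 1) * (δ / (3 * (‖f‖ + 1))) := by field_simp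
    rw [this]
    exact mul_le_mul_of_nonneg_right (by linarith) (by positivity)
  have h0 := htail₀ _ R hR
  have hconv := Metric.tendsto_nhds.1 (hv (fun q => f q * χ R q) (f.continuous.mul (hχc R))
    (hχs R).mul_left) (δ / 3) (by positivity)
  filter_upwards [hR, hconv] with i hi hci
  have h1 := (hsplit R (ν i)).trans (mul_le_mul_of_nonneg_left ((htail R i).trans hi)
    (norm_nonneg f))
  have h2 := (hsplit R ν₀).trans (mul_le_mul_of_nonneg_left h0 (norm_nonneg f))
  rw [Real.dist_eq] at hci ⊢
  rw [abs_le] at h1 h2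
  rw [abs_lt] at hci ⊢
  constructor <;> linarith [h1.1, h1.2, h2.1, h2.2, hci.1, hci.2]

/-! ### Stiff weights: decay, far field and tightness -/

/-- A radially decreasing power function integrates against `μ` at most as much as against Lebesgue
measure, if the same is true of indicators of centred balls. -/
lemma lintegral_rpow_norm_le {n : ℕ} (μ : Measure (Euc n)) {C : ENNReal}
    (hμ : ∀ s : ℝ, 0 < s → μ (Metric.ball 0 s) ≤ C * volume (Metric.ball (0 : Euc n) s))
    {γ ε : ℝ} (hγ : 0 < γ) (hε : 0 < ε) :
    ∫⁻ z, ENNReal.ofReal ((1 + ‖ε⁻¹ • z‖) ^ (-γ)) ∂μ ≤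
      C * ∫⁻ z : Euc n, ENNReal.ofReal ((1 + ‖ε⁻¹ • z‖) ^ (-γ)) := by
  have hpos : ∀ z : Euc n, 0 < 1 + ‖ε⁻¹ • z‖ := fun z => by positivity
  have hcont : Continuous fun z : Euc n => (1 + ‖ε⁻¹ • z‖) ^ (-γ) :=
    Continuous.rpow_const (by fun_prop) fun z => Or.inl (hpos z).ne'
  have h0 : ∀ ν : Measure (Euc n), 0 ≤ᵐ[ν] fun z => (1 + ‖ε⁻¹ • z‖) ^ (-γ) := fun ν =>
    Eventually.of_forall fun z => (Real.rpow_pos_of_pos (hpos z) _).le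
  rw [lintegral_eq_lintegral_meas_lt μ (h0 μ) hcont.aemeasurable,
    lintegral_eq_lintegral_meas_lt volume (h0 volume) hcont.aemeasurable]
  have hanti : Antitone fun t : ℝ => (volume : Measure (Euc n)) {a | t < (1 + ‖ε⁻¹ • a‖) ^ (-γ)} :=
    fun s t hst => measure_mono fun z hz => lt_of_le_of_lt hst hz
  rw [← lintegral_const_mul _ hanti.measurable]
  refine setLIntegral_mono' measurableSet_Ioi fun t ht => ?_
  have ht' : 0 < t := ht
  -- Layer cake: superlevel sets are centred balls, so the hypothesis compares them one by one. For
  -- `t ≥ 1` the radius is nonpositive and the ball is empty.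
  have hset : {z : Euc n | t < (1 + ‖ε⁻¹ • z‖) ^ (-γ)}
      = Metric.ball 0 (ε * (t ^ (-γ)⁻¹ - 1)) := by
    ext z
    simp only [mem_ofPred_eq, Metric.mem_ball, dist_zero_right]
    rw [← Real.lt_rpow_inv_iff_of_neg (hpos z) ht' (by linarith), norm_smul, norm_inv,
      Real.norm_of_nonneg hε.le, ← lt_sub_iff_add_lt', inv_mul_lt_iff₀ hε]
  rw [hset]
  rcases lt_or_ge 0 (ε * (t ^ (-γ)⁻¹ - 1)) with h | h
  · exact hμ _ h
  · rw [Metric.ball_eq_empty.2 h, measure_empty]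
    exact zero_le

/-- The asymptotics of a weight `u(q, ξ(q)/ε)`, where `u` decays in the fast variable like a power
`-γ` with `γ > n` and is dominated in the position variable by an integrable function `w`. -/
structure StiffWeight {d n : ℕ} (u : Euc d → Euc n → ℝ) (w : Euc d → ℝ) (A γ : ℝ) : Prop where
  continuous : Continuous fun x : Euc d × Euc n => u x.1 x.2
  pos : ∀ q z, 0 < u q z
  le : ∀ q z, u q z ≤ A * (1 + ‖z‖) ^ (-γ) * w q
  w_nonneg : ∀ q, 0 ≤ w q
  w_le_one : ∀ q, w q ≤ 1
  integrable_w : Integrable w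
  A_pos : 0 < A
  lt_γ : (n : ℝ) < γ

namespace StiffWeight

variable {d n : ℕ} {u : Euc d → Euc n → ℝ} {w : Euc d → ℝ} {A γ : ℝ}

lemma γ_pos (h : StiffWeight u w A γ) : 0 < γ := (Nat.cast_nonneg n).trans_lt h.lt_γ

lemma integrable_bound (h : StiffWeight u w A γ) :
    Integrable fun z : Euc n => (1 + ‖z‖) ^ (-γ) :=
  integrable_one_add_norm (by simpa using h.lt_γ)

lemma bound_nonneg (z : Euc n) : 0 ≤ (1 + ‖z‖) ^ (-γ) := by positivity

lemma le_bound (h : StiffWeight u w A γ) (q : Euc d) (z : Euc n) :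
    u q z ≤ A * (1 + ‖z‖) ^ (-γ) := by
  refine (h.le q z).trans ?_
  have := mul_nonneg h.A_pos.le (bound_nonneg (γ := γ) z)
  exact mul_le_of_le_one_right this (h.w_le_one q)

lemma le_w (h : StiffWeight u w A γ) (q : Euc d) (z : Euc n) : u q z ≤ A * w q := by
  refine (h.le q z).trans (mul_le_mul_of_nonneg_right ?_ (h.w_nonneg q))
  refine mul_le_of_le_one_right h.A_pos.le ?_
  exact Real.rpow_le_one_of_one_le_of_nonpos (by linarith [norm_nonneg z]) (by linarith [h.γ_pos])

lemma integrable_fast (h : StiffWeight u w A γ) (q : Euc d) : Integrable (u q) := by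
  refine (h.integrable_bound.const_mul A).mono'
    (h.continuous.comp (Continuous.prodMk_right q)).aestronglyMeasurable ?_
  exact Eventually.of_forall fun z => by
    rw [Real.norm_of_nonneg (h.pos q z).le]; exact h.le_bound q z

/-- Since `w ≤ 1`, a single integrable function of `z` dominates `u q` for all `q`. For `u = exp (-β
U)` this gives the regularity of `exp (-β V_eff)`. -/
lemma continuous_integral (h : StiffWeight u w A γ) : Continuous fun q => ∫ z, u q z := by
  refine continuous_of_dominated (bound := fun z => A * (1 + ‖z‖) ^ (-γ))
    (fun q => (h.integrable_fast q).aestronglyMeasurable) (fun q => ?_)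
    (h.integrable_bound.const_mul A)
    (Eventually.of_forall fun z => h.continuous.comp (Continuous.prodMk_left z))
  exact Eventually.of_forall fun z => by
    rw [Real.norm_of_nonneg (h.pos q z).le]; exact h.le_bound q z

lemma integral_pos (h : StiffWeight u w A γ) (q : Euc d) : 0 < ∫ z, u q z := by
  refine (integral_pos_iff_support_of_nonneg (fun z => (h.pos q z).le) (h.integrable_fast q)).2 ?_
  have : Function.support (u q) = univ := by
    ext z; simpa using (h.pos q z).ne'
  rw [this]
  exact isOpen_univ.measure_pos _ univ_nonempty

variable {ξ : Euc d → Euc n}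

lemma continuous_slow (h : StiffWeight u w A γ) (hξ : Continuous ξ) (ε : ℝ) :
    Continuous fun q => u q (ε⁻¹ • ξ q) :=
  h.continuous.comp (by fun_prop : Continuous fun q => (q, ε⁻¹ • ξ q))

lemma integrable_slow (h : StiffWeight u w A γ) (hξ : Continuous ξ) (ε : ℝ) :
    Integrable fun q => u q (ε⁻¹ • ξ q) := by
  refine (h.integrable_w.const_mul A).mono' (h.continuous_slow hξ ε).aestronglyMeasurable ?_
  exact Eventually.of_forall fun q => by
    rw [Real.norm_of_nonneg (h.pos q _).le]; exact h.le_w q _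

/-- The weight away from `{ξ = 0}` is negligible. -/
lemma tendsto_far (h : StiffWeight u w A γ) (hξ : Continuous ξ) {δ : ℝ} (hδ : 0 < δ) :
    Tendsto (fun ε : ℝ => (ε ^ n)⁻¹ * ∫ q in {q | δ ≤ ‖ξ q‖}, u q (ε⁻¹ • ξ q))
      (𝓝[>] 0) (𝓝 0) := by
  have hm : MeasurableSet {q | δ ≤ ‖ξ q‖} := (isClosed_le continuous_const hξ.norm).measurableSet
  -- Where `‖ξ‖ ≥ δ`, the decay bounds `u` by `A * (δ / ε) ^ (-γ) * w`; since `γ > n`, this beats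
  -- the prefactor `(ε ^ n)⁻¹`.
  have hlim : Tendsto (fun ε : ℝ => A * δ ^ (-γ) * (∫ q, w q) * ε ^ (γ - n)) (𝓝[>] 0) (𝓝 0) := by
    have h1 : Tendsto (fun ε : ℝ => ε ^ (γ - n)) (𝓝[>] 0) (𝓝 0) := by
      have h2 : 0 < γ - n := sub_pos.2 h.lt_γ
      have h3 := (Real.continuousAt_rpow_const 0 (γ - n) (Or.inr h2.le)).tendsto
      rw [Real.zero_rpow h2.ne'] at h3
      exact h3.mono_left nhdsWithin_le_nhds
    simpa using h1.const_mul (A * δ ^ (-γ) * (∫ q, w q))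
  refine tendsto_of_tendsto_of_tendsto_of_le_of_le' tendsto_const_nhds hlim ?_ ?_
  · filter_upwards [self_mem_nhdsWithin] with ε (hε : 0 < ε)
    exact mul_nonneg (by positivity) (setIntegral_nonneg hm fun q _ => (h.pos q _).le)
  · filter_upwards [self_mem_nhdsWithin] with ε (hε : 0 < ε)
    have h1 : ∫ q in {q | δ ≤ ‖ξ q‖}, u q (ε⁻¹ • ξ q)
        ≤ ∫ q in {q | δ ≤ ‖ξ q‖}, A * (δ ^ (-γ) * ε ^ γ) * w q := by
      refine setIntegral_mono_on (h.integrable_slow hξ ε).integrableOn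
        (h.integrable_w.const_mul _).integrableOn hm fun q hq => ?_
      refine (h.le q _).trans (mul_le_mul_of_nonneg_right (mul_le_mul_of_nonneg_left ?_
        h.A_pos.le) (h.w_nonneg q))
      have h2 : δ / ε ≤ 1 + ‖ε⁻¹ • ξ q‖ := by
        rw [norm_smul, norm_inv, Real.norm_of_nonneg hε.le, div_eq_inv_mul]
        have := mul_le_mul_of_nonneg_left (show δ ≤ ‖ξ q‖ from hq) (inv_pos.2 hε).le
        linarith
      calc (1 + ‖ε⁻¹ • ξ q‖) ^ (-γ) ≤ (δ / ε) ^ (-γ) :=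
            Real.rpow_le_rpow_of_nonpos (by positivity) h2 (by linarith [h.γ_pos])
        _ = δ ^ (-γ) * ε ^ γ := by
            rw [Real.div_rpow hδ.le hε.le, Real.rpow_neg hε.le, div_inv_eq_mul]
    have h3 : ∫ q in {q | δ ≤ ‖ξ q‖}, A * (δ ^ (-γ) * ε ^ γ) * w q
        ≤ ∫ q, A * (δ ^ (-γ) * ε ^ γ) * w q :=
      setIntegral_le_integral (h.integrable_w.const_mul _) (Eventually.of_forall fun q => by
        have := h.A_pos; have := h.w_nonneg q; positivity)
    rw [integral_const_mul (μ := volume) _ w] at h3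
    have h4 : ε ^ (γ - n) = (ε ^ n)⁻¹ * ε ^ γ := by
      rw [Real.rpow_sub hε, Real.rpow_natCast, div_eq_inv_mul]
    calc (ε ^ n)⁻¹ * ∫ q in {q | δ ≤ ‖ξ q‖}, u q (ε⁻¹ • ξ q)
        ≤ (ε ^ n)⁻¹ * (A * (δ ^ (-γ) * ε ^ γ) * ∫ q, w q) :=
          mul_le_mul_of_nonneg_left (h1.trans h3) (by positivity)
      _ = A * δ ^ (-γ) * (∫ q, w q) * ε ^ (γ - n) := by rw [h4]; ring

/-- The rescaled weight is tight. -/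
lemma eventually_tail_le (h : StiffWeight u w A γ) (hξ : Continuous ξ)
    (hw : ∀ η : ℝ, 0 < η → ∃ R s₀ : ℝ, 0 < s₀ ∧ ∀ s : ℝ, 0 < s → s < s₀ →
      ∫ q in {q | R < ‖q‖ ∧ ‖ξ q‖ < s}, w q ≤ η * s ^ n) {η : ℝ} (hη : 0 < η) :
    ∃ R : ℝ, ∀ᶠ ε in 𝓝[>] (0 : ℝ), (ε ^ n)⁻¹ * ∫ q in {q | R < ‖q‖}, u q (ε⁻¹ • ξ q) ≤ η := by
  let v := (volume : Measure (Euc n)).real (Metric.ball 0 1)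
  have hv : 0 < v := ENNReal.toReal_pos (Metric.measure_ball_pos _ _ one_pos).ne'
    measure_ball_lt_top.ne
  let I := ∫ z : Euc n, (1 + ‖z‖) ^ (-γ)
  have hI : 0 ≤ I := integral_nonneg bound_nonneg
  have hA := h.A_pos
  -- Chosen so that the near part costs at most `η / 2`: `v` converts `s ^ n` into the volume of a
  -- ball, `A * I` is the total of the decay bound, and `+ 1` keeps the denominator positive.
  let η' := η * v / (2 * (A * I + 1))
  have hη' : 0 < η' := by positivity
  obtain ⟨R, s₀, hs₀, hR⟩ := hw η' hη'
  refine ⟨R, ?_⟩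
  let s₁ := s₀ / 2
  have hs₁ : 0 < s₁ := half_pos hs₀
  -- The layer cake needs every radius, while the hypothesis covers only `s < s₀`; restricting to
  -- `‖ξ‖ < s₁` caps the effective radius.
  have hR1 : ∀ s, 0 < s → ∫ q in {q | R < ‖q‖ ∧ ‖ξ q‖ < s₁ ∧ ‖ξ q‖ < s}, w q ≤ η' * s ^ n := by
    intro s hs
    have hm : 0 < min s₁ s := lt_min hs₁ hs
    have h1 := hR (min s₁ s) hm ((min_le_left _ _).trans_lt (half_lt_self hs₀))
    simp only [lt_min_iff] at h1
    refine h1.trans (mul_le_mul_of_nonneg_left ?_ hη'.le)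
    exact pow_le_pow_left₀ hm.le (min_le_right _ _) n
  let T : Set (Euc d) := {q | R < ‖q‖ ∧ ‖ξ q‖ < s₁}
  have hT : MeasurableSet T := ((isOpen_lt continuous_const continuous_norm).inter
    (isOpen_lt hξ.norm continuous_const)).measurableSet
  have hwm : AEMeasurable (fun q => ENNReal.ofReal (w q)) (volume.restrict T) :=
    h.integrable_w.aestronglyMeasurable.aemeasurable.ennreal_ofReal.restrict
  -- The law of `ξ` under `w dq` on `T`: its mass on centred balls is at most `η' / v` times
  -- Lebesgue measure.
  let μ : Measure (Euc n) :=
    ((volume.restrict T).withDensity fun q => ENNReal.ofReal (w q)).map ξ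
  have hμ : ∀ s : ℝ, 0 < s → μ (Metric.ball 0 s)
      ≤ ENNReal.ofReal (η' / v) * volume (Metric.ball (0 : Euc n) s) := by
    intro s hs
    have hB : MeasurableSet (ξ ⁻¹' Metric.ball 0 s) :=
      hξ.measurable Metric.isOpen_ball.measurableSet
    rw [Measure.map_apply hξ.measurable Metric.isOpen_ball.measurableSet,
      withDensity_apply _ hB, Measure.restrict_restrict hB,
      ← ofReal_integral_eq_lintegral_ofReal h.integrable_w.integrableOn
        (Eventually.of_forall h.w_nonneg), Measure.addHaar_ball_of_pos _ _ hs,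
      ← ENNReal.ofReal_toReal (measure_ball_lt_top (μ := (volume : Measure (Euc n)))).ne,
      ← ENNReal.ofReal_mul (by positivity), ← ENNReal.ofReal_mul (by positivity)]
    refine ENNReal.ofReal_le_ofReal ?_
    have hset : ξ ⁻¹' Metric.ball 0 s ∩ T = {q | R < ‖q‖ ∧ ‖ξ q‖ < s₁ ∧ ‖ξ q‖ < s} := by
      ext q
      simp only [T, mem_inter_iff, mem_preimage, Metric.mem_ball, dist_zero_right, mem_ofPred_eq]
      tauto
    rw [hset]
    refine (hR1 s hs).trans_eq ?_
    change η' * s ^ n = η' / v * (s ^ Module.finrank ℝ (Euc n) * v)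
    rw [finrank_euclideanSpace_fin]
    field_simp
  have hnear : ∀ ε : ℝ, 0 < ε → ∫ q in T, u q (ε⁻¹ • ξ q) ≤ ε ^ n * (η / 2) := by
    intro ε hε
    have hbc : Continuous fun z : Euc n => (1 + ‖ε⁻¹ • z‖) ^ (-γ) :=
      Continuous.rpow_const (by fun_prop) fun z =>
        Or.inl (by positivity : (0 : ℝ) < 1 + ‖ε⁻¹ • z‖).ne'
    have hbξ : Continuous fun q => (1 + ‖ε⁻¹ • ξ q‖) ^ (-γ) := hbc.comp hξ
    have hlay := lintegral_rpow_norm_le μ hμ h.γ_pos hε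
    have hbi : Integrable fun z : Euc n => (1 + ‖ε⁻¹ • z‖) ^ (-γ) :=
      h.integrable_bound.comp_smul (inv_ne_zero hε.ne')
    have hright : ∫⁻ z : Euc n, ENNReal.ofReal ((1 + ‖ε⁻¹ • z‖) ^ (-γ))
        = ENNReal.ofReal (ε ^ n * I) := by
      rw [← ofReal_integral_eq_lintegral_ofReal hbi
        (Eventually.of_forall fun z => bound_nonneg _),
        Measure.integral_comp_inv_smul_of_nonneg volume
          (fun z : Euc n => (1 + ‖z‖) ^ (-γ)) hε.le]
      simp [I]
    have hleft : ∫⁻ z, ENNReal.ofReal ((1 + ‖ε⁻¹ • z‖) ^ (-γ)) ∂μ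
        = ∫⁻ q in T, ENNReal.ofReal (w q * (1 + ‖ε⁻¹ • ξ q‖) ^ (-γ)) := by
      rw [lintegral_map hbc.measurable.ennreal_ofReal hξ.measurable,
        lintegral_withDensity_eq_lintegral_mul₀ hwm
          hbξ.measurable.ennreal_ofReal.aemeasurable]
      refine lintegral_congr fun q => ?_
      simp only [Pi.mul_apply]
      rw [ENNReal.ofReal_mul (h.w_nonneg q)]
    rw [hleft, hright, ← ENNReal.ofReal_mul (by positivity)] at hlay
    have h1 : ∫⁻ q in T, ENNReal.ofReal (u q (ε⁻¹ • ξ q))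
        ≤ ENNReal.ofReal (A * (η' / v * (ε ^ n * I))) := by
      rw [ENNReal.ofReal_mul hA.le]
      refine le_trans ?_ (mul_le_mul_right hlay _)
      rw [← lintegral_const_mul' _ _ ENNReal.ofReal_ne_top]
      refine lintegral_mono fun q => ?_
      rw [← ENNReal.ofReal_mul hA.le]
      refine ENNReal.ofReal_le_ofReal ((h.le q _).trans_eq ?_)
      ring
    rw [← ofReal_integral_eq_lintegral_ofReal (h.integrable_slow hξ ε).integrableOn
      (Eventually.of_forall fun q => (h.pos q _).le)] at h1
    have h2 := (ENNReal.ofReal_le_ofReal_iff (by positivity)).1 h1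
    refine h2.trans ?_
    have h3 : A * (η' / v * (ε ^ n * I)) = ε ^ n * (η / 2) * (A * I / (A * I + 1)) := by
      simp only [η']
      have : A * I + 1 ≠ 0 := by positivity
      field_simp
    rw [h3]
    refine mul_le_of_le_one_right (by positivity) ?_
    rw [div_le_one (by positivity)]
    linarith
  filter_upwards [self_mem_nhdsWithin,
    (h.tendsto_far hξ hs₁).eventually_le_const (half_pos hη)] with ε (hε : 0 < ε) hfar
  have hui := h.integrable_slow hξ ε
  have hu0 : ∀ q, 0 ≤ u q (ε⁻¹ • ξ q) := fun q => (h.pos q _).le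
  have hfm : MeasurableSet {q | s₁ ≤ ‖ξ q‖} :=
    (isClosed_le continuous_const hξ.norm).measurableSet
  have hsplit : ∫ q in {q | R < ‖q‖}, u q (ε⁻¹ • ξ q)
      ≤ (∫ q in T, u q (ε⁻¹ • ξ q)) + ∫ q in {q | s₁ ≤ ‖ξ q‖}, u q (ε⁻¹ • ξ q) := by
    have hRm : MeasurableSet {q : Euc d | R < ‖q‖} :=
      (isOpen_lt continuous_const continuous_norm).measurableSet
    rw [← integral_indicator hT, ← integral_indicator hfm, ← integral_indicator hRm,
      ← integral_add (hui.indicator hT) (hui.indicator hfm)]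
    refine integral_mono (hui.indicator hRm) ((hui.indicator hT).add (hui.indicator hfm))
      fun q => ?_
    have := hu0 q
    simp only [T, Set.indicator_apply, mem_ofPred_eq]
    by_cases hq1 : R < ‖q‖ <;> by_cases hq2 : ‖ξ q‖ < s₁ <;>
      simp [hq1, hq2, not_le.2, not_lt.1, this]
  have hεn : (0 : ℝ) < ε ^ n := by positivity
  calc (ε ^ n)⁻¹ * ∫ q in {q | R < ‖q‖}, u q (ε⁻¹ • ξ q)
      ≤ (ε ^ n)⁻¹ * ((∫ q in T, u q (ε⁻¹ • ξ q)) + ∫ q in {q | s₁ ≤ ‖ξ q‖}, u q (ε⁻¹ • ξ q)) :=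
        mul_le_mul_of_nonneg_left hsplit (by positivity)
    _ = (ε ^ n)⁻¹ * (∫ q in T, u q (ε⁻¹ • ξ q))
        + (ε ^ n)⁻¹ * ∫ q in {q | s₁ ≤ ‖ξ q‖}, u q (ε⁻¹ • ξ q) := mul_add _ _ _
    _ ≤ (ε ^ n)⁻¹ * (ε ^ n * (η / 2)) + η / 2 :=
        add_le_add (mul_le_mul_of_nonneg_left (hnear ε hε) (by positivity)) hfar
    _ = η := by field_simp; ring

end StiffWeight

/-! ### Vague limit of the rescaled weights -/

namespace StiffWeight

variable {d n : ℕ} {u : Euc d → Euc n → ℝ} {w : Euc d → ℝ} {A γ : ℝ} {ξ : Euc d → Euc n}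

/-- The rescaled weight converges vaguely to the conditional measure on `{ξ = 0}`, weighted by
the integral of `u` over the fast variable. -/
lemma tendsto_vague (h : StiffWeight u w A γ) (hξ : Continuous ξ) {r : ℝ} (hr : 0 < r)
    {κ : ProbabilityTheory.Kernel (Euc n) (Euc d)} (hκ : IsConditionalMeasure ξ r κ)
    {φ : Euc d → ℝ} (hφ : Continuous φ) (hφs : HasCompactSupport φ) :
    Tendsto (fun ε : ℝ => (ε ^ n)⁻¹ * ∫ q, φ q * u q (ε⁻¹ • ξ q)) (𝓝[>] 0)
      (𝓝 (∫ q, φ q * (∫ z, u q z) ∂(κ 0))) := by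
  have h0r : ‖(0 : Euc n)‖ < r := by simpa using hr
  have := hκ.locallyFinite 0 h0r
  obtain ⟨r', hr', hr'r⟩ := exists_between hr
  have hA := h.A_pos
  have huc : ∀ z, Continuous fun q => u q z := fun z =>
    h.continuous.comp (Continuous.prodMk_left z)
  have hball : Metric.ball (0 : Euc n) r' ⊆ Metric.ball 0 r := Metric.ball_subset_ball hr'r.le
  have hbm : MeasurableSet (Metric.ball (0 : Euc n) r') := Metric.isOpen_ball.measurableSet
  have hpre : ξ ⁻¹' Metric.ball 0 r' = {q | r' ≤ ‖ξ q‖}ᶜ := by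
    ext q; simp
  have hfm : MeasurableSet {q | r' ≤ ‖ξ q‖} :=
    (isClosed_le continuous_const hξ.norm).measurableSet
  obtain ⟨B, hB⟩ := hφ.bounded_above_of_compact_support hφs
  have hB0 : 0 ≤ B := (norm_nonneg _).trans (hB 0)
  have hφu : ∀ ε : ℝ, Integrable fun q => φ q * u q (ε⁻¹ • ξ q) := fun ε =>
    (hφ.mul (h.continuous_slow hξ ε)).integrable_of_hasCompactSupport hφs.mul_right
  -- the contribution of `{‖ξ‖ ≥ r'}`
  have hfar : Tendsto (fun ε : ℝ => (ε ^ n)⁻¹ *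
      ∫ q in {q | r' ≤ ‖ξ q‖}, φ q * u q (ε⁻¹ • ξ q)) (𝓝[>] 0) (𝓝 0) := by
    have h1 := (h.tendsto_far hξ hr').const_mul B
    rw [mul_zero] at h1
    refine squeeze_zero_norm' ?_ h1
    filter_upwards [self_mem_nhdsWithin] with ε (hε : 0 < ε)
    have hεn : (0 : ℝ) < ε ^ n := by positivity
    rw [norm_mul, Real.norm_of_nonneg (inv_pos.2 hεn).le, mul_left_comm]
    refine mul_le_mul_of_nonneg_left ?_ (inv_pos.2 hεn).le
    rw [← integral_const_mul]
    refine norm_integral_le_of_norm_le ((h.integrable_slow hξ ε).const_mul B).integrableOn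
      (Eventually.of_forall fun q => ?_)
    rw [norm_mul, Real.norm_of_nonneg (h.pos q _).le]
    exact mul_le_mul_of_nonneg_right (hB q) (h.pos q _).le
  -- the contribution of `{‖ξ‖ < r'}`
  let H : Euc n → Euc n → ℝ := fun z y => ∫ q, φ q * u q y ∂(κ z)
  have hnear : Tendsto (fun ε : ℝ => ∫ y : Euc n,
      (Metric.ball (0 : Euc n) r').indicator (fun z => H z y) (ε • y)) (𝓝[>] 0)
      (𝓝 (∫ y, H 0 y)) := by
    have hφa : Continuous fun q => |φ q| := hφ.abs
    have hφas : HasCompactSupport fun q => |φ q| := hφs.norm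
    obtain ⟨D, hD⟩ := (isCompact_closedBall (0 : Euc n) r').exists_bound_of_continuousOn
      ((hκ.continuous _ hφa hφas).mono (Metric.closedBall_subset_ball hr'r))
    have hD0 : 0 ≤ D := (norm_nonneg _).trans (hD 0 (Metric.mem_closedBall_self hr'.le))
    refine tendsto_integral_filter_of_dominated_convergence
      (fun y => A * (1 + ‖y‖) ^ (-γ) * D) ?_ ?_ ((h.integrable_bound.const_mul A).mul_const D) ?_
    · filter_upwards [self_mem_nhdsWithin] with ε (hε : 0 < ε)
      -- In `H (ε • y) y` the variable `y` enters twice. As `κ (ε • y)` lives on `{ξ = ε • y}`, the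
      -- second `y` may be replaced by `ε⁻¹ • ξ q`, leaving a kernel integral evaluated at `ε • y`.
      have h1 : StronglyMeasurable fun z => ∫ q, φ q * u q (ε⁻¹ • ξ q) ∂(κ z) :=
        StronglyMeasurable.integral_kernel (hφ.mul (h.continuous_slow hξ ε)).stronglyMeasurable
      have h2 := ((h1.indicator hbm).comp_measurable (measurable_const_smul ε))
      refine h2.aestronglyMeasurable.congr (Eventually.of_forall fun y => ?_)
      simp only [Function.comp_apply]
      by_cases hy : ε • y ∈ Metric.ball (0 : Euc n) r'
      · rw [Set.indicator_of_mem hy, Set.indicator_of_mem hy]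
        refine integral_congr_ae ?_
        filter_upwards [hκ.ae_eq (by simpa using hball hy)] with q hq
        rw [hq, inv_smul_smul₀ hε.ne']
      · rw [Set.indicator_of_notMem hy, Set.indicator_of_notMem hy]
    · refine Eventually.of_forall fun ε => Eventually.of_forall fun y => ?_
      by_cases hy : ε • y ∈ Metric.ball (0 : Euc n) r'
      · rw [Set.indicator_of_mem hy]
        have := hκ.locallyFinite (ε • y) (by simpa using hball hy)
        have h1 : ‖H (ε • y) y‖ ≤ ∫ q, A * (1 + ‖y‖) ^ (-γ) * |φ q| ∂(κ (ε • y)) := by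
          refine norm_integral_le_of_norm_le
            ((hφa.integrable_of_hasCompactSupport hφas).const_mul _)
            (Eventually.of_forall fun q => ?_)
          rw [norm_mul, Real.norm_of_nonneg (h.pos q y).le, mul_comm, Real.norm_eq_abs]
          exact mul_le_mul_of_nonneg_right (h.le_bound q y) (abs_nonneg _)
        rw [integral_const_mul] at h1
        refine h1.trans (mul_le_mul_of_nonneg_left ?_
          (mul_nonneg hA.le (bound_nonneg _)))
        exact (le_abs_self _).trans (hD _ (Metric.ball_subset_closedBall hy))
      · rw [Set.indicator_of_notMem hy, norm_zero]
        exact mul_nonneg (mul_nonneg hA.le (bound_nonneg _)) hD0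
    · refine Eventually.of_forall fun y => ?_
      -- The pointwise limit is where the continuous choice of `κ` near `0` is essential.
      have h1 : ContinuousAt (fun z => H z y) 0 :=
        (hκ.continuous _ (hφ.mul (huc y)) hφs.mul_right).continuousAt
          (Metric.ball_mem_nhds 0 hr)
      have h2 : Tendsto (fun ε : ℝ => ε • y) (𝓝[>] 0) (𝓝 0) := by
        have h3 : Continuous fun ε : ℝ => ε • y := by fun_prop
        simpa using (h3.tendsto 0).mono_left nhdsWithin_le_nhds
      refine (h1.tendsto.comp h2).congr' ?_
      filter_upwards [h2 (Metric.ball_mem_nhds 0 hr')] with ε hε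
      exact (Set.indicator_of_mem (show ε • y ∈ Metric.ball 0 r' from hε) fun z => H z y).symm
  have hlim : ∫ y : Euc n, H 0 y = ∫ q, φ q * (∫ z, u q z) ∂(κ 0) := by
    have hint : Integrable (Function.uncurry fun (y : Euc n) q => φ q * u q y)
        (volume.prod (κ 0)) := by
      have h1 : Integrable (fun x : Euc n × Euc d => A * (1 + ‖x.1‖) ^ (-γ) * |φ x.2|)
          (volume.prod (κ 0)) :=
        (h.integrable_bound.const_mul A).mul_prod
          (hφ.abs.integrable_of_hasCompactSupport hφs.norm)
      refine h1.mono' ?_ (Eventually.of_forall fun x => ?_)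
      · exact ((hφ.comp continuous_snd).mul
          (h.continuous.comp continuous_swap)).aestronglyMeasurable
      · simp only [Function.uncurry]
        rw [norm_mul, Real.norm_of_nonneg (h.pos _ _).le, mul_comm, Real.norm_eq_abs]
        exact mul_le_mul_of_nonneg_right (h.le_bound _ _) (abs_nonneg _)
    rw [integral_integral_swap hint]
    simp_rw [integral_const_mul]
  rw [← hlim]
  have hsum := hnear.add hfar
  rw [add_zero] at hsum
  refine hsum.congr' ?_
  filter_upwards [self_mem_nhdsWithin] with ε (hε : 0 < ε)
  have h1 : ∫ q in ξ ⁻¹' Metric.ball 0 r', φ q * u q (ε⁻¹ • ξ q)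
      = ∫ z, (Metric.ball (0 : Euc n) r').indicator (fun z' => H z' (ε⁻¹ • z)) z := by
    rw [hκ.setIntegral_preimage hξ (hφu ε) hbm hball, ← integral_indicator hbm]
    refine integral_congr_ae (Eventually.of_forall fun z => ?_)
    by_cases hz : z ∈ Metric.ball (0 : Euc n) r'
    · simp only [Set.indicator_of_mem hz]
      refine integral_congr_ae ?_
      filter_upwards [hκ.ae_eq (by simpa using hball hz)] with q hq
      rw [hq]
    · simp only [Set.indicator_of_notMem hz]
  have h2 : ∫ y : Euc n, (Metric.ball (0 : Euc n) r').indicator (fun z => H z y) (ε • y)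
      = (ε ^ n)⁻¹ * ∫ q in ξ ⁻¹' Metric.ball 0 r', φ q * u q (ε⁻¹ • ξ q) := by
    rw [h1]
    have h3 := Measure.integral_comp_smul_of_nonneg (volume : Measure (Euc n))
      (fun z => (Metric.ball (0 : Euc n) r').indicator (fun z' => H z' (ε⁻¹ • z)) z) ε (hR := hε.le)
    simp only [inv_smul_smul₀ hε.ne', finrank_euclideanSpace_fin, smul_eq_mul] at h3
    exact h3
  rw [h2, ← mul_add, hpre, add_comm, integral_add_compl hfm (hφu ε)]

end StiffWeight

/-! ### Product structure, kinetic energy and decay of the Boltzmann factor -/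

/-- A tilt by a sum of functions of the two coordinates is a product of tilts. -/
lemma tilted_add_prod {X Y : Type*} [MeasurableSpace X] [MeasurableSpace Y] (μ : Measure X)
    (ν : Measure Y) [SFinite μ] [SFinite ν] {f : X → ℝ} {g : Y → ℝ} (hf : Measurable f)
    (hg : Measurable g) :
    (μ.prod ν).tilted (fun x => f x.1 + g x.2) = (μ.tilted f).prod (ν.tilted g) := by
  simp only [Measure.tilted]
  rw [prod_withDensity (hf.exp.div_const _).ennreal_ofReal (hg.exp.div_const _).ennreal_ofReal]
  congr 1
  ext x
  rw [← ENNReal.ofReal_mul (div_nonneg (Real.exp_pos _).le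
    (integral_nonneg fun _ => (Real.exp_pos _).le))]
  simp_rw [Real.exp_add]
  rw [integral_prod_mul (fun x => Real.exp (f x)) fun y => Real.exp (g y), div_mul_div_comm]

lemma continuous_kineticEnergy {d : ℕ} (M : Matrix (Fin d) (Fin d) ℝ) :
    Continuous (kineticEnergy M) := by
  unfold kineticEnergy
  simp only [dotProduct, Matrix.mulVec]
  fun_prop

/-- The constant is the minimum on the unit sphere, positive by compactness and definiteness;
homogeneity of degree two extends the bound. The empty sphere (`d = 0`) is handled separately. -/
lemma exists_le_kineticEnergy {d : ℕ} {M : Matrix (Fin d) (Fin d) ℝ} (hM : M.PosDef) :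
    ∃ b : ℝ, 0 < b ∧ ∀ p, b * ‖p‖ ^ 2 ≤ kineticEnergy M p := by
  have hpos : ∀ p : Euc d, p ≠ 0 → 0 < kineticEnergy M p := fun p hp => by
    have h1 : p.ofLp ≠ 0 := fun h => hp (by ext i; exact congrFun h i)
    have h2 := hM.inv.dotProduct_mulVec_pos h1
    simp only [star_trivial] at h2
    exact mul_pos (by norm_num) h2
  have hscale : ∀ (t : ℝ) (p : Euc d), kineticEnergy M (t • p) = t ^ 2 * kineticEnergy M p :=
    fun t p => by
      simp only [kineticEnergy, WithLp.ofLp_smul, Matrix.mulVec_smul, smul_dotProduct,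
        dotProduct_smul, smul_eq_mul]
      ring
  rcases (Metric.sphere (0 : Euc d) 1).eq_empty_or_nonempty with hempty | hne
  · refine ⟨1, one_pos, fun p => ?_⟩
    have hp : p = 0 := by
      by_contra hp
      have : ‖p‖⁻¹ • p ∈ Metric.sphere (0 : Euc d) 1 := by
        simp [norm_smul, norm_ne_zero_iff.2 hp]
      rw [hempty] at this
      exact this
    simp [hp, kineticEnergy]
  · obtain ⟨p₀, hp₀, hmin⟩ := (isCompact_sphere (0 : Euc d) 1).exists_isMinOn hne
      (continuous_kineticEnergy M).continuousOn
    have hp₀' : p₀ ≠ 0 := fun h => by simp [h] at hp₀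
    refine ⟨kineticEnergy M p₀, hpos p₀ hp₀', fun p => ?_⟩
    by_cases hp : p = 0
    · simp [hp, kineticEnergy]
    · have hn : ‖p‖ ≠ 0 := norm_ne_zero_iff.2 hp
      have hmem : ‖p‖⁻¹ • p ∈ Metric.sphere (0 : Euc d) 1 := by simp [norm_smul, hn]
      have h1 : kineticEnergy M p₀ ≤ kineticEnergy M (‖p‖⁻¹ • p) := hmin hmem
      have h2 : kineticEnergy M p = ‖p‖ ^ 2 * kineticEnergy M (‖p‖⁻¹ • p) := by
        rw [← hscale, smul_inv_smul₀ hn]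
      rw [h2, mul_comm]
      exact mul_le_mul_of_nonneg_left h1 (by positivity)

lemma integrable_exp_neg_kineticEnergy {d : ℕ} {M : Matrix (Fin d) (Fin d) ℝ} (hM : M.PosDef)
    {β : ℝ} (hβ : 0 < β) : Integrable fun p => Real.exp (-β * kineticEnergy M p) := by
  obtain ⟨b, hb, hle⟩ := exists_le_kineticEnergy hM
  have h1 := (GaussianFourier.integrable_cexp_neg_mul_sq_norm_add (V := Euc d)
    (b := ((β * b : ℝ) : ℂ)) (by simpa using mul_pos hβ hb) 0 0).norm
  refine h1.mono' ((continuous_kineticEnergy M).const_mul _).rexp.aestronglyMeasurable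
    (Eventually.of_forall fun p => ?_)
  rw [Real.norm_of_nonneg (Real.exp_pos _).le, Complex.norm_exp]
  refine Real.exp_le_exp.2 ?_
  have h2 : (-((β * b : ℝ) : ℂ) * (‖p‖ : ℂ) ^ 2 + 0 * ((inner ℝ 0 p : ℝ) : ℂ)).re
      = -(β * (b * ‖p‖ ^ 2)) := by
    rw [zero_mul, add_zero, ← Complex.ofReal_neg, ← Complex.ofReal_pow, ← Complex.ofReal_mul,
      Complex.ofReal_re]
    ring
  rw [h2, neg_mul]
  exact neg_le_neg (mul_le_mul_of_nonneg_left (hle p) hβ.le)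

/-- Logarithmic growth of the potential gives power decay of its Boltzmann factor. -/
lemma exists_exp_neg_le_rpow {n : ℕ} {β c C : ℝ} (hβ : 0 < β) (hc : 0 < β * c) {K : Euc n → ℝ}
    (hKbdd : ∀ z, C ≤ K z)
    (hKlog : ∀ᶠ z in Bornology.cobounded (Euc n), c * Real.log ‖z‖ < K z) :
    ∃ A : ℝ, 0 < A ∧ ∀ z, Real.exp (-β * K z) ≤ A * (1 + ‖z‖) ^ (-(β * c)) := by
  obtain ⟨R₀, -, hR₀⟩ := (Metric.hasBasis_cobounded_compl_closedBall (0 : Euc n)).eventually_iff.1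
    hKlog
  let R := max R₀ 1
  have hR : 0 < R := one_pos.trans_le (le_max_right _ _)
  -- The first summand serves `‖z‖ ≤ R`, through `K ≥ C`. The second serves `‖z‖ > R ≥ 1`, where
  -- `‖z‖ ≥ (1 + ‖z‖) / 2`.
  refine ⟨Real.exp (-β * C) * (1 + R) ^ (β * c) + 2 ^ (β * c), by positivity, fun z => ?_⟩
  have hz : 0 < 1 + ‖z‖ := by positivity
  have hzγ : 0 < (1 + ‖z‖) ^ (-(β * c)) := Real.rpow_pos_of_pos hz _
  rw [add_mul]
  rcases le_or_gt ‖z‖ R with h | h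
  · refine le_add_of_le_of_nonneg ?_ (by positivity)
    have h1 : 1 ≤ (1 + R) ^ (β * c) * (1 + ‖z‖) ^ (-(β * c)) := by
      rw [Real.rpow_neg hz.le, ← div_eq_mul_inv, one_le_div (by positivity)]
      exact Real.rpow_le_rpow hz.le (by linarith) hc.le
    calc Real.exp (-β * K z) ≤ Real.exp (-β * C) :=
          Real.exp_le_exp.2 (by nlinarith [hKbdd z])
      _ ≤ Real.exp (-β * C) * ((1 + R) ^ (β * c) * (1 + ‖z‖) ^ (-(β * c))) :=
          le_mul_of_one_le_right (Real.exp_pos _).le h1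
      _ = _ := by ring
  · refine le_add_of_nonneg_of_le (by positivity) ?_
    have hz1 : 1 < ‖z‖ := (le_max_right _ _).trans_lt h
    have hz0 : 0 < ‖z‖ := one_pos.trans hz1
    have h1 : c * Real.log ‖z‖ < K z := hR₀ (by
      simpa using (le_max_left R₀ 1).trans_lt h)
    calc Real.exp (-β * K z) ≤ Real.exp (Real.log ‖z‖ * (-(β * c))) :=
          Real.exp_le_exp.2 (by nlinarith)
      _ = ‖z‖ ^ (-(β * c)) := (Real.rpow_def_of_pos hz0 _).symm
      _ ≤ ((1 + ‖z‖) / 2) ^ (-(β * c)) :=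
          Real.rpow_le_rpow_of_nonpos (by positivity) (by linarith) (by linarith)
      _ = 2 ^ (β * c) * (1 + ‖z‖) ^ (-(β * c)) := by
          rw [Real.div_rpow hz.le zero_le_two, Real.rpow_neg zero_le_two, div_inv_eq_mul, mul_comm]

/-! ### Weak limit of the rescaled weights -/

namespace StiffWeight

variable {d n : ℕ} {u : Euc d → Euc n → ℝ} {w : Euc d → ℝ} {A γ : ℝ} {ξ : Euc d → Euc n}

/-- The rescaled weight converges weakly, and its limit is finite. -/
lemma integrable_and_tendsto (h : StiffWeight u w A γ) (hξ : Continuous ξ) {r : ℝ} (hr : 0 < r)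
    {κ : ProbabilityTheory.Kernel (Euc n) (Euc d)} (hκ : IsConditionalMeasure ξ r κ)
    (hw : ∀ η : ℝ, 0 < η → ∃ R s₀ : ℝ, 0 < s₀ ∧ ∀ s : ℝ, 0 < s → s < s₀ →
      ∫ q in {q | R < ‖q‖ ∧ ‖ξ q‖ < s}, w q ≤ η * s ^ n) :
    Integrable (fun q => ∫ z, u q z) (κ 0) ∧
      ∀ f : BoundedContinuousFunction (Euc d) ℝ,
        Tendsto (fun ε : ℝ => (ε ^ n)⁻¹ * ∫ q, u q (ε⁻¹ • ξ q) * f q) (𝓝[>] 0)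
          (𝓝 (∫ q, (∫ z, u q z) * f q ∂(κ 0))) := by
  have := hκ.locallyFinite 0 (by simpa using hr)
  have hGc := h.continuous_integral
  have hG0 : ∀ q, 0 ≤ ∫ z, u q z := fun q => (h.integral_pos q).le
  let ν : ℝ → Measure (Euc d) := fun ε =>
    volume.withDensity fun q => ENNReal.ofReal ((ε ^ n)⁻¹ * u q (ε⁻¹ • ξ q))
  let ν₀ : Measure (Euc d) := (κ 0).withDensity fun q => ENNReal.ofReal (∫ z, u q z)
  have hνfin : ∀ ε, IsFiniteMeasure (ν ε) := fun ε =>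
    isFiniteMeasure_withDensity_ofReal ((h.integrable_slow hξ ε).const_mul _).2
  have hν₀ : IsLocallyFiniteMeasure ν₀ := IsLocallyFiniteMeasure.withDensity_ofReal hGc
  have hνint : ∀ ε : ℝ, 0 < ε → ∀ f : Euc d → ℝ,
      ∫ q, f q ∂(ν ε) = (ε ^ n)⁻¹ * ∫ q, u q (ε⁻¹ • ξ q) * f q := by
    intro ε hε f
    rw [integral_withDensity_eq_integral_toReal_smul
      ((h.continuous_slow hξ ε).const_mul _).measurable.ennreal_ofReal (by simp),
      ← integral_const_mul]
    refine integral_congr_ae (Eventually.of_forall fun q => ?_)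
    simp only [smul_eq_mul]
    rw [ENNReal.toReal_ofReal (mul_nonneg (by positivity) (h.pos q _).le), mul_assoc]
  have hν₀int : ∀ f : Euc d → ℝ, ∫ q, f q ∂ν₀ = ∫ q, (∫ z, u q z) * f q ∂(κ 0) := by
    intro f
    rw [integral_withDensity_eq_integral_toReal_smul hGc.measurable.ennreal_ofReal (by simp)]
    refine integral_congr_ae (Eventually.of_forall fun q => ?_)
    simp only [smul_eq_mul]
    rw [ENNReal.toReal_ofReal (hG0 q)]
  obtain ⟨hfin, hconv⟩ := tendsto_integral_of_vague_of_tight (l := 𝓝[>] (0 : ℝ)) ν ν₀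
    (fun φ hφ hφs => by
      rw [hν₀int]
      have h1 := h.tendsto_vague hξ hr hκ hφ hφs
      simp_rw [mul_comm (φ _)] at h1
      refine h1.congr' ?_
      filter_upwards [self_mem_nhdsWithin] with ε (hε : 0 < ε)
      exact (hνint ε hε φ).symm)
    (fun η hη => by
      obtain ⟨R, hR⟩ := h.eventually_tail_le hξ hw hη
      refine ⟨R, ?_⟩
      filter_upwards [hR, self_mem_nhdsWithin] with ε hεR (hε : 0 < ε)
      have hm : MeasurableSet {q : Euc d | R < ‖q‖} :=
        (isOpen_lt continuous_const continuous_norm).measurableSet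
      refine le_of_eq_of_le ?_ hεR
      rw [← integral_indicator_one hm, hνint ε hε, ← integral_indicator hm]
      congr 2
      ext q
      by_cases hq : q ∈ {q : Euc d | R < ‖q‖}
      · rw [Set.indicator_of_mem hq, Set.indicator_of_mem hq, Pi.one_apply, mul_one]
      · rw [Set.indicator_of_notMem hq, Set.indicator_of_notMem hq, mul_zero])
  refine ⟨⟨hGc.aestronglyMeasurable, ?_⟩, fun f => ?_⟩
  · rw [hasFiniteIntegral_iff_ofReal (Eventually.of_forall hG0)]
    have h1 := hfin.measure_univ_lt_top
    rwa [withDensity_apply _ MeasurableSet.univ, Measure.restrict_univ] at h1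
  · rw [← hν₀int]
    refine (hconv f).congr' ?_
    filter_upwards [self_mem_nhdsWithin] with ε (hε : 0 < ε)
    exact hνint ε hε f

end StiffWeight

/-! ### The main theorem -/

theorem lemmal {d n : ℕ} (M : Matrix (Fin d) (Fin d) ℝ) (hM : M.PosDef)
    (β : ℝ) (hβ : 0 < β)
    (ξ : Euc d → Euc n) (hξ : ContDiff ℝ ∞ ξ)
    (r : ℝ) (hr : 0 < r)
    (hreg : ∀ q, ‖ξ q‖ < r → Function.Surjective (fderiv ℝ ξ q))
    (hne : ∃ q, ξ q = 0)
    (U : Euc d → Euc n → ℝ) (hU : Continuous (fun x : Euc d × Euc n => U x.1 x.2))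
    -- confinement in the fast variable, `U(q,z) ≥ K(z)` with `K` of logarithmic growth,
    -- the excess of `U` over `K` being at least `W(q) ≥ 0`
    (K : Euc n → ℝ) (W : Euc d → ℝ) (hW : ∀ q, 0 ≤ W q)
    (hUKW : ∀ q z, K z + W q ≤ U q z)
    (hKbdd : ∃ C : ℝ, ∀ z, C ≤ K z)
    (c : ℝ) (hc : (n : ℝ) < β * c)
    (hKlog : ∀ᶠ z in Bornology.cobounded (Euc n), c * Real.log ‖z‖ < K z)
    -- integrability in the position variable, globally and along the level sets near `{ξ = 0}`
    (hWint : Integrable (fun q => Real.exp (-β * W q)))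
    (hWtail : ∀ η : ℝ, 0 < η → ∃ R s₀ : ℝ, 0 < s₀ ∧ ∀ s : ℝ, 0 < s → s < s₀ →
      ∫ q in {q | R < ‖q‖ ∧ ‖ξ q‖ < s}, Real.exp (-β * W q) ≤ η * s ^ n) :
    -- the stiff Boltzmann distributions and the effective potential are well defined
    (∀ ε : ℝ, 0 < ε →
      Integrable (fun x => Real.exp (-β * stiffHamiltonian M U ξ ε x)) ∧
      IsProbabilityMeasure (boltzmann volume β (stiffHamiltonian M U ξ ε))) ∧
    (∀ q, Integrable (fun z => Real.exp (-β * U q z))) ∧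
    -- there is exactly one family of conditional measures `δ_{ξ(q)=z}(dq)`, `‖z‖ < r`
    ∃ κ : ProbabilityTheory.Kernel (Euc n) (Euc d), IsConditionalMeasure ξ r κ ∧
      (∀ κ' : ProbabilityTheory.Kernel (Euc n) (Euc d), IsConditionalMeasure ξ r κ' →
        ∀ z, ‖z‖ < r → κ' z = κ z) ∧
      -- the limit measure is well defined
      Integrable (fun x => Real.exp (-β * effHamiltonian M β U x)) (volume.prod (κ 0)) ∧
      IsProbabilityMeasure (boltzmann (volume.prod (κ 0)) β (effHamiltonian M β U)) ∧
      -- convergence in distribution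
      (∀ f : BoundedContinuousFunction (Euc d × Euc d) ℝ,
        Tendsto (fun ε : ℝ => ∫ x, f x ∂(boltzmann volume β (stiffHamiltonian M U ξ ε)))
          (𝓝[>] 0)
          (𝓝 (∫ x, f x ∂(boltzmann (volume.prod (κ 0)) β (effHamiltonian M β U))))) ∧
      -- the limit is supported on the slow manifold
      boltzmann (volume.prod (κ 0)) β (effHamiltonian M β U) {x | ξ x.2 ≠ 0} = 0 ∧
      -- the marginal distribution in position
      Integrable (fun q => Real.exp (-β * effPotential β U q)) (κ 0) ∧
      IsProbabilityMeasure (boltzmann (κ 0) β (effPotential β U)) ∧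
      (boltzmann (volume.prod (κ 0)) β (effHamiltonian M β U)).map Prod.snd =
        boltzmann (κ 0) β (effPotential β U) := by
  have hξc : Continuous ξ := hξ.continuous
  obtain ⟨C, hC⟩ := hKbdd
  have hβc : 0 < β * c := (Nat.cast_nonneg n).trans_lt hc
  obtain ⟨A, hA, hAK⟩ := exists_exp_neg_le_rpow hβ hβc hC hKlog
  let u : Euc d → Euc n → ℝ := fun q z => Real.exp (-β * U q z)
  let w : Euc d → ℝ := fun q => Real.exp (-β * W q)
  have hu : StiffWeight u w A (β * c) :=
    { continuous := (hU.const_mul (-β)).rexp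
      pos := fun q z => Real.exp_pos _
      le := fun q z => by
        refine le_trans ?_ (mul_le_mul_of_nonneg_right (hAK z) (Real.exp_pos _).le)
        rw [← Real.exp_add]
        exact Real.exp_le_exp.2 (by nlinarith [hUKW q z])
      w_nonneg := fun q => (Real.exp_pos _).le
      w_le_one := fun q => Real.exp_le_one_iff.2 (by nlinarith [hW q])
      integrable_w := hWint
      A_pos := hA
      lt_γ := hc }
  -- the kinetic part factors out
  let k : Euc d → ℝ := fun p => -β * kineticEnergy M p
  have hkm : Measurable k := ((continuous_kineticEnergy M).const_mul _).measurable
  have hkint : Integrable fun p => Real.exp (k p) := integrable_exp_neg_kineticEnergy hM hβ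
  let P : Measure (Euc d) := volume.tilted k
  have hP : IsProbabilityMeasure P := isProbabilityMeasure_tilted hkint
  let Ue : ℝ → Euc d → ℝ := fun ε q => -β * U q (ε⁻¹ • ξ q)
  have hUe : ∀ ε, Continuous (Ue ε) := fun ε =>
    (hU.comp (by fun_prop : Continuous fun q => (q, ε⁻¹ • ξ q))).const_mul _
  have hUeint : ∀ ε, Integrable fun q => Real.exp (Ue ε q) := fun ε => hu.integrable_slow hξc ε
  have hstiff : ∀ ε, (fun x => -β * stiffHamiltonian M U ξ ε x)
      = fun x => k x.1 + Ue ε x.2 := fun ε => by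
    ext x; simp only [stiffHamiltonian, k, Ue]; ring
  have hboltz : ∀ ε, boltzmann volume β (stiffHamiltonian M U ξ ε)
      = P.prod (volume.tilted (Ue ε)) := fun ε => by
    rw [boltzmann, hstiff, Measure.volume_eq_prod, tilted_add_prod _ _ hkm (hUe ε).measurable]
  have hQ : ∀ ε, IsProbabilityMeasure ((volume : Measure (Euc d)).tilted (Ue ε)) := fun ε =>
    isProbabilityMeasure_tilted (hUeint ε)
  -- the effective potential
  have hexpV : ∀ q, Real.exp (-β * effPotential β U q) = ∫ z, u q z := fun q => by
    have h1 : -β * effPotential β U q = Real.log (∫ z, u q z) := by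
      simp only [effPotential, u]; field_simp
    rw [h1, Real.exp_log (hu.integral_pos q)]
  let V : Euc d → ℝ := fun q => -β * effPotential β U q
  have hVm : Measurable V :=
    ((hu.continuous_integral.measurable.log).const_mul _).const_mul _
  have hVexp : ∀ q, Real.exp (V q) = ∫ z, u q z := hexpV
  have heff : (fun x => -β * effHamiltonian M β U x) = fun x => k x.1 + V x.2 := by
    ext x; simp only [effHamiltonian, k, V]; ring
  obtain ⟨q₀, hq₀⟩ := hne
  obtain ⟨κ, hκ, hκne⟩ := exists_isConditionalMeasure hξ hreg ⟨q₀, by simpa [hq₀] using hr⟩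
  have := hκ.locallyFinite 0 (by simpa using hr)
  -- Without this the limiting partition function could vanish and the normalized measure would be
  -- zero.
  have hκ0 : NeZero (κ 0) := ⟨by rw [← hq₀]; exact hκne q₀ (by simpa [hq₀] using hr)⟩
  obtain ⟨hGint, hconv⟩ := hu.integrable_and_tendsto hξc hr hκ hWtail
  have hVint : Integrable (fun q => Real.exp (V q)) (κ 0) := by
    simp_rw [hVexp]; exact hGint
  have hQ₀ : IsProbabilityMeasure ((κ 0).tilted V) := isProbabilityMeasure_tilted hVint
  have hboltz₀ : boltzmann (volume.prod (κ 0)) β (effHamiltonian M β U)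
      = P.prod ((κ 0).tilted V) := by
    rw [boltzmann, heff, tilted_add_prod _ _ hkm hVm]
  have hmarg : ∀ f : BoundedContinuousFunction (Euc d) ℝ,
      Tendsto (fun ε : ℝ => ∫ q, f q ∂((volume : Measure (Euc d)).tilted (Ue ε))) (𝓝[>] 0)
        (𝓝 (∫ q, f q ∂((κ 0).tilted V))) := by
    intro f
    have hform : ∀ {μ : Measure (Euc d)} (g f : Euc d → ℝ), ∫ q, f q ∂(μ.tilted g)
        = (∫ q, Real.exp (g q) * f q ∂μ) / ∫ q, Real.exp (g q) ∂μ := by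
      intro μ g f
      rw [integral_tilted, ← integral_div]
      refine integral_congr_ae (Eventually.of_forall fun q => ?_)
      simp only [smul_eq_mul]
      ring
    have hZ₀ : 0 < ∫ q, (∫ z, u q z) ∂(κ 0) := by
      have h1 := integral_exp_pos hVint
      simpa only [hVexp] using h1
    have h1 := hconv (BoundedContinuousFunction.const _ 1)
    simp only [BoundedContinuousFunction.const_apply, mul_one] at h1
    -- Dividing by the case `f = 1` normalizes, and the common factor `(ε ^ n)⁻¹` cancels.
    have h2 := (hconv f).div h1 hZ₀.ne'
    rw [hform]
    simp only [hVexp]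
    refine h2.congr' ?_
    filter_upwards [self_mem_nhdsWithin] with ε (hε : 0 < ε)
    rw [hform]
    exact mul_div_mul_left _ _ (by positivity)
  have hξ0m : MeasurableSet {q | ξ q ≠ 0} :=
    (isOpen_ne_fun hξc continuous_const).measurableSet
  refine ⟨fun ε _ => ⟨?_, ?_⟩, hu.integrable_fast, κ, hκ,
    fun κ' hκ' z hz => hκ.unique hκ' hξc hz, ?_, ?_, fun f => ?_, ?_, hVint, hQ₀, ?_⟩
  · simp_rw [congrFun (hstiff ε), Real.exp_add]
    exact hkint.mul_prod (hUeint ε)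
  · rw [hboltz]; infer_instance
  · simp_rw [congrFun heff, Real.exp_add]
    exact hkint.mul_prod hVint
  · rw [hboltz₀]; infer_instance
  -- The momentum law `P` does not depend on `ε`, so averaging `f` over `p` gives a bounded
  -- continuous test function of `q` alone.
  · have hFc : Continuous fun q => ∫ p, f (p, q) ∂P :=
      continuous_of_dominated (bound := fun _ => ‖f‖)
        (fun q => (f.continuous.comp (Continuous.prodMk_left q)).aestronglyMeasurable)
        (fun q => Eventually.of_forall fun p => f.norm_coe_le_norm _) (integrable_const _)
        (Eventually.of_forall fun p => f.continuous.comp (Continuous.prodMk_right p))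
    have hFb : ∀ q, ‖∫ p, f (p, q) ∂P‖ ≤ ‖f‖ := fun q => by
      simpa using norm_integral_le_of_norm_le_const (μ := P) (C := ‖f‖)
        (Eventually.of_forall fun p => f.norm_coe_le_norm (p, q))
    have h1 := hmarg (BoundedContinuousFunction.ofNormedAddCommGroup _ hFc _ hFb)
    have h2 : ∀ (μ : Measure (Euc d)) [IsProbabilityMeasure μ],
        ∫ q, ∫ p, f (p, q) ∂P ∂μ = ∫ x, f x ∂(P.prod μ) := fun μ _ =>
      (integral_prod_symm _ (f.integrable _)).symm
    simp only [BoundedContinuousFunction.coe_ofNormedAddCommGroup, h2] at h1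
    simpa only [hboltz, hboltz₀] using h1
  · have h1 : (κ 0).tilted V {q | ξ q ≠ 0} = 0 :=
      tilted_absolutelyContinuous _ _ (hκ.carried 0 (by simpa using hr))
    rw [hboltz₀]
    refine (Measure.measure_prod_null (measurable_snd hξ0m)).2 (Eventually.of_forall fun p => h1)
  · rw [hboltz₀, Measure.map_snd_prod, measure_univ, one_smul]
    rfl
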